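/- **Theorem.** For $L\ge 0$ let $\mathcal H_L=(\mathbb C^3)^{\otimes L}$, with an additional auxiliary space $h_0=\mathbb C^3$. On $\mathbb C^3\otimes\mathbb C^3$ let $P$ be the permutation operator, let $K=P^{t_2}$ be the trace operator ($K=\sum_{a,c}|aa\rangle\langle cc|$), and put $$R(u)=\frac{u+iP}{u+i},\qquad R^{\bar3}(u)=\frac{u+\frac{3i}{2}-iK}{u+\frac{3i}{2}} .$$ Define the operators on $\mathcal H_L$ $$t(u)=\mathrm{Tr}_0\,R_{10}(u)R_{20}(u)\cdots R_{L0}(u),\qquad \bar t(u)=\mathrm{Tr}_0\,R_{L0}(u)\cdots R_{20}(u)R_{10}(u),$$ and $t^{\bar3}(u)$, $\bar t^{\bar3}(u)$ in the same way from $R^{\bar3}$, and $$X(u)=-i\,\bar t(-u)\,\partial_u t(u),\qquad Y(u)=-i\,\bar t^{\bar3}(-u)\,\partial_u t^{\bar3}(u).$$ Let $\langle A,B\rangle=3^{-L}\,\mathrm{Tr}(A^\dagger B)$ and $\|A\|^2=\langle A,A\rangle$ be the Hilbert–Schmidt scalar product and squared norm on $\mathrm{End}(\mathcal H_L)$, and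 let $\{A\}=A-3^{-L}\,\mathrm{Tr}(A)$ be the traceless part of $A$. Then for every $u\in\mathbb C$ with $|\mathrm{Im}\,u|<\frac12$ the sequences of traceless operators $A_L=\{X(u)\}$ and $A_L=\{Y(u)\}$ are quasi-local. That is, each of them has the following properties: 1. $A_L$ is translation invariant (it commutes with the cyclic one-site shift) for every $L$; 2. $\|A_L\|^2\sim L$: the limit $\lim_{L\to\infty}\|A_L\|^2/L$ exists and is a finite, strictly positive number (depending on $u$); 3. for every $k$ and every operator $b$ on the first $k$ sites, the overlap $\langle b\otimes 1_{L-k},A_L\rangle$ converges to a finite limit as $L\to\infty$. -/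

import Mathlib

open scoped Matrix

noncomputable section

namespace SU3Chain

/-- Linear operators on the space `(ℂ³)^{⊗ L}` of a chain of `L` sites, written as matrices in the
product basis; a basis state is a configuration `s : Fin L → Fin 3`. -/
abbrev Op (L : ℕ) : Type := Matrix (Fin L → Fin 3) (Fin L → Fin 3) ℂ

/-- Linear operators on `(ℂ³)^{⊗ L} ⊗ ℂ³`; the last factor is the auxiliary space. -/
abbrev AuxOp (L : ℕ) : Type := Matrix ((Fin L → Fin 3) × Fin 3) ((Fin L → Fin 3) × Fin 3) ℂ

/-- Linear operators on `ℂ³ ⊗ ℂ³`; first factor quantum, second factor auxiliary. -/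
abbrev TwoOp : Type := Matrix (Fin 3 × Fin 3) (Fin 3 × Fin 3) ℂ

/-! ### Quasi-local sequences of operators -/

/-- The Hilbert-Schmidt scalar product `⟨A, B⟩ = 3^{-L} Tr (A† B)`. -/
def hsInner {L : ℕ} (A B : Op L) : ℂ := ((3 : ℂ) ^ L)⁻¹ * (Aᴴ * B).trace

/-- The squared Hilbert-Schmidt norm `‖A‖² = ⟨A, A⟩`. -/
def hsNormSq {L : ℕ} (A : Op L) : ℝ := (hsInner A A).re

/-- The traceless part `{A} = A - 3^{-L} Tr A`. -/
def tracelessPart {L : ℕ} (A : Op L) : Op L :=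
  A - (((3 : ℂ) ^ L)⁻¹ * A.trace) • (1 : Op L)

/-- The cyclic one-site translation of the periodic chain. -/
def translation (L : ℕ) : Op L :=
  Matrix.of fun s s' => if s = s' ∘ finRotate L then 1 else 0

/-- The operator `b ⊗ 1` on `k + n` sites, where `b` acts on the first `k` sites. -/
def localOp {k : ℕ} (b : Op k) (n : ℕ) : Op (k + n) :=
  Matrix.of fun s s' =>
    b (s ∘ Fin.castAdd n) (s' ∘ Fin.castAdd n) *
      (if s ∘ Fin.natAdd k = s' ∘ Fin.natAdd k then 1 else 0)

/-- A sequence of traceless operators, one for each chain length, is quasi-local if it is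
translation invariant, its squared Hilbert-Schmidt norm is asymptotically proportional to the
length of the chain, and its overlap with each operator of finite support converges. -/
structure IsQuasiLocal (A : ∀ L : ℕ, Op L) : Prop where
  traceless : ∀ L : ℕ, (A L).trace = 0
  translation_invariant : ∀ L : ℕ, translation L * A L = A L * translation L
  norm_sq_linear : ∃ c : ℝ, 0 < c ∧
    Filter.Tendsto (fun L : ℕ => hsNormSq (A L) / (L : ℝ)) Filter.atTop (nhds c)
  local_overlap : ∀ (k : ℕ) (b : Op k), ∃ l : ℂ,
    Filter.Tendsto (fun n : ℕ => hsInner (localOp b n) (A (k + n))) Filter.atTop (nhds l)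

/-! ### Transfer matrices of the chain -/

/-- The permutation operator `P (v ⊗ w) = w ⊗ v`. -/
def permOp : TwoOp := Matrix.of fun p q => if p.1 = q.2 ∧ p.2 = q.1 then 1 else 0

/-- The trace operator `K`, the partial transpose of `P`. -/
def traceOp : TwoOp := Matrix.of fun p q => if p.1 = p.2 ∧ q.1 = q.2 then 1 else 0

/-- `R(u) = (u + i P) / (u + i)`. -/
def R (u : ℂ) : TwoOp := (u + Complex.I)⁻¹ • (u • (1 : TwoOp) + Complex.I • permOp)

/-- `R^{3̄}(u) = (u + 3i/2 - i K) / (u + 3i/2)`. -/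
def Rbar (u : ℂ) : TwoOp :=
  (u + 3 * Complex.I / 2)⁻¹ • ((u + 3 * Complex.I / 2) • (1 : TwoOp) - Complex.I • traceOp)

/-- The operator `M_{j0}`: `M` acts on the site `j` and on the auxiliary space, and the identity
acts on all other sites. -/
def onSite {L : ℕ} (M : TwoOp) (j : Fin L) : AuxOp L :=
  Matrix.of fun p q =>
    M (p.1 j, p.2) (q.1 j, q.2) * (if ∀ k : Fin L, k ≠ j → p.1 k = q.1 k then 1 else 0)

/-- The partial trace over the auxiliary space. -/
def auxTrace {L : ℕ} (M : AuxOp L) : Op L :=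
  Matrix.of fun s s' => ∑ a : Fin 3, M (s, a) (s', a)

/-- `Tr₀ M_{10} M_{20} ⋯ M_{L0}`. -/
def transfer (M : TwoOp) (L : ℕ) : Op L :=
  auxTrace (List.ofFn fun j : Fin L => onSite M j).prod

/-- The space reflected `Tr₀ M_{L0} ⋯ M_{20} M_{10}`. -/
def transferReflected (M : TwoOp) (L : ℕ) : Op L :=
  auxTrace (List.ofFn fun j : Fin L => onSite M j).reverse.prod

/-- The (entrywise) derivative of an operator valued function of the spectral parameter. -/
def opDeriv {L : ℕ} (F : ℂ → Op L) (u : ℂ) : Op L :=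
  Matrix.of fun s s' => deriv (fun z : ℂ => F z s s') u

/-- `-i t̄(-u) ∂ᵤ t(u)` for the transfer matrices `t`, `t̄` built from the `R`-matrix `M`. -/
def chargeOf (M : ℂ → TwoOp) (u : ℂ) (L : ℕ) : Op L :=
  (-Complex.I) • (transferReflected (M (-u)) L * opDeriv (fun z => transfer (M z) L) u)

/-- `X(u) = -i t̄(-u) ∂ᵤ t(u)`, defining representation. -/
def X (u : ℂ) (L : ℕ) : Op L := chargeOf R u L

/-- `Y(u) = -i t̄^{3̄}(-u) ∂ᵤ t^{3̄}(u)`, conjugate representation. -/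
def Y (u : ℂ) (L : ℕ) : Op L := chargeOf Rbar u L

/-- The physical strip `|Im u| < 1/2`. -/
def physicalStrip : Set ℂ := {u : ℂ | |u.im| < 1 / 2}

end SU3Chain

end

/-!
The product `t̄(-u) t(v)` is a matrix product operator (`mpo`) whose auxiliary space consists of two
copies of `ℂ³` (`siteFamily`), and the charge is its derivative in `v` at `v = u`, that is, a sum
over the sites `k` of the operators in which the site matrix `W u` is replaced by its derivative
`W'` at the site `k` (`chargeOf_eq_sum`). By `SU(3)` symmetry everything is governed by the
decomposition of `ℂ³ ⊗ ℂ³` into the singlet and the octet, with projections `singletProj` and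
`octetProj`.

Unitarity of the `R`-matrix says that the singlet is a left eigenvector of the site matrices, with
the identity operator as its eigenvalue. Hence the site matrices are block triangular, and each term
of the charge is a scalar plus a sum of *strings* plus a *winding term* (`density_eq`). A string
enters the octet at the site `k`, where the derivative acts, stays there for `m` sites, and leaves
it for the singlet at the next one; it acts as the identity on all further sites. The winding term
stays in the octet around the whole ring.

The sum of the diagonal site matrices is a combination of the two projections. Therefore the
vertices at both ends of a string have vanishing partial trace, and different strings are
orthogonal, so long as they do not overlap around the ring (`hsInner_shiftOp_stringOp`). Norms are
computed with the completely positive map `cpMap`: it multiplies `octetProj` by a number `λ`, so the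
string that stays for `m` sites has squared norm `g γ λ ^ m`, where `g` and `γ` come from the two
vertices. If `λ < 1`, long strings and the winding term are negligible, and the squared norm per
site tends to `g γ / (1 - λ)` (`tendsto_hsNormSq`). The overlap with a local operator is obtained by
summing out the other sites, where the averaged site matrix acts by `1` on the singlet and by a
number of modulus less than `1` on the octet (`local_overlap`).

It remains to compute these numbers (`isContracting_permSite` and `isContracting_traceSite`). With
`ν = |u² + 1|⁻²` for `X` and `ν = |u² + 9/4|⁻²` for `Y`, one finds `γ = ν`, `g = 8 ν / 9` and
`1 - λ = (1 - 4 (Im u)²) ν`, so that the condition `λ < 1` is exactly `|Im u| < 1/2`.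
-/

namespace SU3Chain

/-! ### Ordered products over the sites and matrix product operators -/

section Lists

theorem sum_prod_ofFn {σ S : Type*} [Fintype σ] [Semiring S] :
    ∀ {L : ℕ} (f : Fin L → σ → S),
      ∑ s : Fin L → σ, (List.ofFn fun j => f j (s j)).prod =
        (List.ofFn fun j => ∑ x, f j x).prod
  | 0, f => by simp
  | L + 1, f => by
    rw [← (Fin.consEquiv fun _ : Fin (L + 1) => σ).sum_comp, Fintype.sum_prod_type]
    simp only [Fin.consEquiv_apply, List.ofFn_succ, Fin.cons_zero, Fin.cons_succ, List.prod_cons]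
    rw [← sum_prod_ofFn, Finset.sum_mul_sum]

variable {ι κ : Type*} [Fintype ι] [DecidableEq ι] [Fintype κ] [DecidableEq κ]

theorem kronecker_prod_ofFn : ∀ {L : ℕ} (A : Fin L → Matrix ι ι ℂ) (B : Fin L → Matrix κ κ ℂ),
    Matrix.kronecker (List.ofFn A).prod (List.ofFn B).prod =
      (List.ofFn fun j => Matrix.kronecker (A j) (B j)).prod
  | 0, A, B => by simp [Matrix.kronecker, Matrix.kroneckerMap_one_one]
  | L + 1, A, B => by
    simp only [List.ofFn_succ, List.prod_cons]
    rw [← kronecker_prod_ofFn]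
    exact Matrix.mul_kronecker_mul _ _ _ _

theorem transpose_prod_ofFn {L : ℕ} (A : Fin L → Matrix ι ι ℂ) :
    (List.ofFn A).reverse.prodᵀ = (List.ofFn fun j => (A j)ᵀ).prod := by
  rw [Matrix.transpose_list_prod, List.map_reverse, List.reverse_reverse, List.map_ofFn]
  rfl

theorem star_trace_prod_ofFn {L : ℕ} (A : Fin L → Matrix ι ι ℂ) :
    star (List.ofFn A).prod.trace = (List.ofFn fun j => (A j).map star).prod.trace := by
  have h : (List.ofFn fun j => (A j).map star).prod = (List.ofFn A).prod.map star := by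
    have := map_list_prod (starRingEnd ℂ).mapMatrix (List.ofFn A)
    rw [List.map_ofFn] at this
    exact this.symm
  rw [h]
  simp [Matrix.trace, Matrix.map_apply]

/-- A trace of an ordered product over the sites of a ring does not depend on the first site. -/
theorem trace_prod_ofFn_add {n : ℕ} (A : Fin (n + 1) → Matrix ι ι ℂ) (k : Fin (n + 1)) :
    (List.ofFn fun j => A (j + k)).prod.trace = (List.ofFn A).prod.trace := by
  have one : ∀ A : Fin (n + 1) → Matrix ι ι ℂ,
      (List.ofFn fun j => A (j + 1)).prod.trace = (List.ofFn A).prod.trace := by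
    intro A
    rw [List.ofFn_succ' (fun j => A (j + 1)), List.ofFn_succ (f := A), List.concat_eq_append,
      List.prod_append, List.prod_cons, List.prod_cons, List.prod_nil, mul_one,
      Matrix.trace_mul_comm]
    simp
  induction k using Fin.induction with
  | zero => simp
  | succ i ih =>
    rw [← ih, ← one fun j => A (j + i.castSucc)]
    congr! 5 with j
    rw [← Fin.coeSucc_eq_succ]
    abel

end Lists

/-- The operator whose entry between `s` and `t` is the trace of the ordered product of the
matrices `f j (s j) (t j)` attached to the sites. -/
def mpo {ι : Type*} [Fintype ι] [DecidableEq ι] {L : ℕ}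
    (f : Fin L → Fin 3 → Fin 3 → Matrix ι ι ℂ) : Op L :=
  Matrix.of fun s t => (List.ofFn fun j => f j (s j) (t j)).prod.trace

section Transfer

/-- The block of `M` between the states `s` and `t` of the quantum factor. -/
def siteBlock (M : TwoOp) (s t : Fin 3) : Matrix (Fin 3) (Fin 3) ℂ :=
  Matrix.of fun a b => M (s, a) (t, b)

/-- An ordered product over distinct sites factorizes into the blocks at these sites, and is the
identity on all other ones. -/
theorem prod_map_onSite {L : ℕ} (M : TwoOp) (l : List (Fin L)) (hl : l.Nodup)
    (s t : Fin L → Fin 3) (a b : Fin 3) :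
    (l.map (onSite M)).prod (s, a) (t, b) =
      (l.map fun j => siteBlock M (s j) (t j)).prod a b *
        if ∀ k, k ∉ l → s k = t k then 1 else 0 := by
  classical
  induction l generalizing s a with
  | nil =>
    simp only [List.map_nil, List.prod_nil, Matrix.one_apply, Prod.mk.injEq, List.not_mem_nil,
      not_false_eq_true, forall_const, ← funext_iff]
    split_ifs <;> simp_all
  | cons i l ih =>
    obtain ⟨hi, hl⟩ := List.nodup_cons.1 hl
    rw [List.map_cons, List.prod_cons, Matrix.mul_apply, List.map_cons, List.prod_cons,
      Matrix.mul_apply, Fintype.sum_prod_type, Finset.sum_comm, Finset.sum_mul]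
    refine Finset.sum_congr rfl fun c _ => ?_
    -- only the configuration that agrees with `t` at the site `i` and with `s` elsewhere counts
    rw [Finset.sum_eq_single (Function.update s i (t i))]
    · rw [ih hl]
      have h1 : (l.map fun j => siteBlock M (Function.update s i (t i) j) (t j)) =
          l.map fun j => siteBlock M (s j) (t j) := by
        refine List.map_congr_left fun j hj => ?_
        rw [Function.update_of_ne]
        rintro rfl
        exact hi hj
      have h2 : (∀ k, k ∉ l → Function.update s i (t i) k = t k) ↔
          ∀ k, k ∉ i :: l → s k = t k := by
        refine forall_congr' fun k => ?_
        by_cases hk : k = i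
        · subst hk; simp
        · simp [hk]
      rw [h1]
      simp only [h2, onSite, siteBlock, Matrix.of_apply, Function.update_self]
      rw [if_pos, mul_one, mul_assoc]
      intro k hk
      rw [Function.update_of_ne hk]
    · intro r _ hr
      rw [ih hl, onSite, Matrix.of_apply]
      by_cases h1 : ∀ k, k ≠ i → s k = r k
      · rw [if_neg (c := ∀ k, k ∉ l → r k = t k)]
        · simp
        · intro h2
          apply hr
          funext k
          by_cases hk : k = i
          · subst hk; simp [h2 k hi]
          · rw [Function.update_of_ne hk, h1 k hk]
      · rw [if_neg h1]; simp
    · simp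

theorem transfer_eq_mpo (M : TwoOp) (L : ℕ) : transfer M L = mpo fun _ => siteBlock M := by
  ext s t
  have h := fun a => prod_map_onSite M (List.finRange L) (List.nodup_finRange L) s t a a
  simp only [← List.ofFn_eq_map] at h
  simp only [transfer, auxTrace, mpo, Matrix.of_apply, h]
  simp [Matrix.trace]

/-- Reversing the order of the sites amounts to transposing the auxiliary space. -/
theorem transferReflected_eq_mpo (M : TwoOp) (L : ℕ) :
    transferReflected M L = mpo fun _ s t => (siteBlock M s t)ᵀ := by
  ext s t
  have h := fun a => prod_map_onSite M (List.finRange L).reverse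
    (List.nodup_reverse.2 (List.nodup_finRange L)) s t a a
  simp only [List.map_reverse, ← List.ofFn_eq_map] at h
  simp only [transferReflected, auxTrace, mpo, Matrix.of_apply, h]
  rw [← transpose_prod_ofFn, Matrix.trace_transpose]
  simp [Matrix.trace]

/-- The site matrix of a product of two matrix product operators: the product over the physical
states, tensored over the auxiliary spaces. -/
def fuse {ι κ : Type*} (f : Fin 3 → Fin 3 → Matrix ι ι ℂ) (g : Fin 3 → Fin 3 → Matrix κ κ ℂ)
    (s t : Fin 3) : Matrix (ι × κ) (ι × κ) ℂ :=
  ∑ r, Matrix.kronecker (f s r) (g r t)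

theorem mpo_mul_mpo {ι κ : Type*} [Fintype ι] [DecidableEq ι] [Fintype κ] [DecidableEq κ] {L : ℕ}
    (f : Fin L → Fin 3 → Fin 3 → Matrix ι ι ℂ) (g : Fin L → Fin 3 → Fin 3 → Matrix κ κ ℂ) :
    mpo f * mpo g = mpo fun j => fuse (f j) (g j) := by
  ext s t
  simp only [Matrix.mul_apply, mpo, Matrix.of_apply, fuse]
  rw [← sum_prod_ofFn fun j r => Matrix.kronecker (f j (s j) r) (g j r (t j)), Matrix.trace_sum]
  refine Finset.sum_congr rfl fun r _ => ?_
  rw [← kronecker_prod_ofFn]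
  exact (Matrix.trace_kronecker _ _).symm

end Transfer

/-! ### The charge as a sum over the sites, and translation invariance -/

section Derivative

variable {ι : Type*} [Fintype ι]

theorem hasDerivAt_mul_apply {F G : ℂ → Matrix ι ι ℂ} {F' G' : Matrix ι ι ℂ} {u : ℂ}
    (hF : ∀ a b, HasDerivAt (fun v => F v a b) (F' a b) u)
    (hG : ∀ a b, HasDerivAt (fun v => G v a b) (G' a b) u) (a b : ι) :
    HasDerivAt (fun v => (F v * G v) a b) ((F' * G u + F u * G') a b) u := by
  simp only [Matrix.mul_apply, Matrix.add_apply, ← Finset.sum_add_distrib]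
  exact HasDerivAt.fun_sum fun c _ => (hF a c).mul (hG c b)

theorem hasDerivAt_trace {F : ℂ → Matrix ι ι ℂ} {F' : Matrix ι ι ℂ} {u : ℂ}
    (hF : ∀ a b, HasDerivAt (fun v => F v a b) (F' a b) u) :
    HasDerivAt (fun v => (F v).trace) F'.trace u := by
  simp only [Matrix.trace, Matrix.diag]
  exact HasDerivAt.fun_sum fun a _ => hF a a

variable [DecidableEq ι]

theorem hasDerivAt_prod_ofFn_apply {u : ℂ} : ∀ {L : ℕ} {F : Fin L → ℂ → Matrix ι ι ℂ}
    {F' : Fin L → Matrix ι ι ℂ}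
    (_ : ∀ j a b, HasDerivAt (fun v => F j v a b) (F' j a b) u) (a b : ι),
    HasDerivAt (fun v => (List.ofFn fun j => F j v).prod a b)
      ((∑ k, (List.ofFn fun j => if j = k then F' j else F j u).prod) a b) u
  | 0, F, F', h, a, b => by simpa using hasDerivAt_const u _
  | L + 1, F, F', h, a, b => by
    simp only [List.ofFn_succ, List.prod_cons, Fin.sum_univ_succ, Fin.succ_ne_zero, if_true,
      if_false, Fin.succ_inj, (Fin.succ_ne_zero _).symm, ← Finset.mul_sum]
    exact hasDerivAt_mul_apply (h 0)
      (hasDerivAt_prod_ofFn_apply (F := fun j => F j.succ) (F' := fun j => F' j.succ)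
        fun j => h j.succ) a b

theorem hasDerivAt_mpo_apply {u : ℂ} {L : ℕ} {W : ℂ → Fin 3 → Fin 3 → Matrix ι ι ℂ}
    {W' : Fin 3 → Fin 3 → Matrix ι ι ℂ}
    (h : ∀ s t a b, HasDerivAt (fun v => W v s t a b) (W' s t a b) u) (s t : Fin L → Fin 3) :
    HasDerivAt (fun v => mpo (fun _ : Fin L => W v) s t)
      ((∑ k : Fin L, mpo fun j => if j = k then W' else W u) s t) u := by
  have := hasDerivAt_trace (hasDerivAt_prod_ofFn_apply (L := L)
    (F := fun j v => W v (s j) (t j)) (F' := fun j => W' (s j) (t j)) (fun j => h (s j) (t j)))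
  have e : (∑ k : Fin L, mpo fun j => if j = k then W' else W u) s t =
      (∑ k : Fin L, (List.ofFn fun j =>
        if j = k then W' (s j) (t j) else W u (s j) (t j)).prod).trace := by
    simp only [Matrix.sum_apply, mpo, Matrix.of_apply, Matrix.trace_sum]
    congr! 5 with k _ j
    split_ifs <;> rfl
  rw [e]
  exact this

end Derivative

section Charge

/-- Linear operators on two copies `ℂ³ ⊗ ℂ³` of the auxiliary space. -/
abbrev PairOp : Type := Matrix (Fin 3 × Fin 3) (Fin 3 × Fin 3) ℂ

/-- The site matrix of `t̄(-u) t(v)`: it acts on two copies of the auxiliary space, the first one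
being transposed. -/
def siteFamily (M : ℂ → TwoOp) (u v : ℂ) : Fin 3 → Fin 3 → PairOp :=
  fuse (fun s t => (siteBlock (M (-u)) s t)ᵀ) (siteBlock (M v))

theorem reflected_mul_transfer (M : ℂ → TwoOp) (u v : ℂ) (L : ℕ) :
    transferReflected (M (-u)) L * transfer (M v) L = mpo fun _ => siteFamily M u v := by
  rw [transfer_eq_mpo, transferReflected_eq_mpo, mpo_mul_mpo]
  rfl

theorem siteFamily_apply (M : ℂ → TwoOp) (u v : ℂ) (s t a b c d : Fin 3) :
    siteFamily M u v s t (a, b) (c, d) = ∑ r, M (-u) (s, c) (r, a) * M v (r, b) (t, d) := by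
  simp [siteFamily, fuse, siteBlock, Matrix.sum_apply, Matrix.kroneckerMap_apply]

/-- By the product rule, the charge is the sum over the sites of the matrix product operators in
which the site matrix is differentiated at that site. -/
theorem chargeOf_eq_sum {M : ℂ → TwoOp} {u : ℂ} {M' : TwoOp}
    (hM : ∀ p q, HasDerivAt (fun v => M v p q) (M' p q) u)
    {W' : Fin 3 → Fin 3 → PairOp}
    (hW : ∀ s t a b, HasDerivAt (fun v => siteFamily M u v s t a b) (W' s t a b) u) (L : ℕ) :
    chargeOf M u L =
      (-Complex.I) • ∑ k : Fin L, mpo fun j => if j = k then W' else siteFamily M u u := by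
  rw [chargeOf]
  congr 1
  ext s t
  refine HasDerivAt.unique ?_ (hasDerivAt_mpo_apply hW s t)
  simp only [← reflected_mul_transfer, Matrix.mul_apply]
  refine HasDerivAt.fun_sum fun r _ => HasDerivAt.const_mul _ ?_
  rw [opDeriv, Matrix.of_apply]
  refine DifferentiableAt.hasDerivAt ?_
  simp only [transfer_eq_mpo]
  exact (hasDerivAt_mpo_apply (W' := siteBlock M') (fun s t a b => hM _ _) r t).differentiableAt

end Charge

section Translation

/-- An operator with translation invariant entries commutes with the translation. -/
theorem translation_mul_comm {L : ℕ} {A : Op L}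
    (h : ∀ s t, A (s ∘ finRotate L) (t ∘ finRotate L) = A s t) :
    translation L * A = A * translation L := by
  ext s t
  have h1 : ∀ r, translation L s r = if r = s ∘ (finRotate L).symm then 1 else 0 := by
    intro r
    rw [translation, Matrix.of_apply]
    congr 1
    rw [Equiv.eq_comp_symm]
    exact propext eq_comm
  simp only [Matrix.mul_apply, h1]
  simp only [translation, Matrix.of_apply, ite_mul, one_mul, zero_mul, mul_ite, mul_one, mul_zero,
    Finset.sum_ite_eq', Finset.mem_univ, if_true]
  rw [← h, Function.comp_assoc, Equiv.symm_comp_self, Function.comp_id]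

theorem mpo_const_comp_finRotate {ι : Type*} [Fintype ι] [DecidableEq ι] {L : ℕ}
    (f : Fin 3 → Fin 3 → Matrix ι ι ℂ) (s t : Fin L → Fin 3) :
    mpo (fun _ => f) (s ∘ finRotate L) (t ∘ finRotate L) = mpo (fun _ => f) s t := by
  cases L with
  | zero => congr!
  | succ n =>
    simp only [mpo, Matrix.of_apply, Function.comp_apply, finRotate_apply]
    exact trace_prod_ofFn_add (fun j => f (s j) (t j)) 1

theorem tracelessPart_chargeOf_translation (M : ℂ → TwoOp) (u : ℂ) (L : ℕ) :
    translation L * tracelessPart (chargeOf M u L) =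
      tracelessPart (chargeOf M u L) * translation L := by
  have h1 : translation L * transferReflected (M (-u)) L =
      transferReflected (M (-u)) L * translation L := by
    apply translation_mul_comm
    intro s t
    rw [transferReflected_eq_mpo]
    exact mpo_const_comp_finRotate _ s t
  have h2 : translation L * opDeriv (fun z => transfer (M z) L) u =
      opDeriv (fun z => transfer (M z) L) u * translation L := by
    apply translation_mul_comm
    intro s t
    simp only [transfer_eq_mpo, opDeriv, Matrix.of_apply]
    congr 1
    funext z
    exact mpo_const_comp_finRotate _ s t
  rw [tracelessPart, chargeOf, mul_sub, sub_mul, mul_smul_comm, smul_mul_assoc, mul_smul_comm,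
    smul_mul_assoc, mul_one, one_mul, ← mul_assoc, h1, mul_assoc, h2, mul_assoc]

end Translation

/-! ### Singlet and octet, and the Hilbert-Schmidt scalar product -/

section Projections

/-- The projection of two copies of `ℂ³` onto the singlet `∑ a, |a a⟩`. -/
noncomputable def singletProj : PairOp :=
  Matrix.of fun p q => if p.1 = p.2 ∧ q.1 = q.2 then 1 / 3 else 0

/-- The complementary projection, onto the traceless tensors. -/
noncomputable def octetProj : PairOp := 1 - singletProj

theorem singletProj_apply (a b c d : Fin 3) :
    singletProj (a, b) (c, d) = if a = b ∧ c = d then 1 / 3 else 0 := rfl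

theorem singletProj_mul_mul_self (Y : PairOp) :
    singletProj * Y * singletProj = (singletProj * Y).trace • singletProj := by
  ext ⟨a, b⟩ ⟨c, d⟩
  by_cases h1 : a = b <;> by_cases h2 : c = d <;>
    simp [Matrix.mul_apply, Matrix.trace, Fintype.sum_prod_type, singletProj_apply, h1, h2,
      ite_and, ← Finset.sum_mul, ← Finset.mul_sum]

theorem trace_singletProj : singletProj.trace = 1 := by
  simp [Matrix.trace, Fintype.sum_prod_type, singletProj_apply]

theorem singletProj_mul_self : singletProj * singletProj = singletProj := by
  have := singletProj_mul_mul_self 1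
  simpa [trace_singletProj] using this

theorem conjTranspose_singletProj : singletProjᴴ = singletProj := by
  ext ⟨a, b⟩ ⟨c, d⟩
  simp only [Matrix.conjTranspose_apply, singletProj_apply, and_comm]
  split_ifs <;> simp

theorem conjTranspose_octetProj : octetProjᴴ = octetProj := by
  simp [octetProj, conjTranspose_singletProj]

theorem octetProj_mul_self : octetProj * octetProj = octetProj := by
  simp [octetProj, mul_sub, sub_mul, singletProj_mul_self]

theorem singletProj_mul_octetProj : singletProj * octetProj = 0 := by
  simp [octetProj, mul_sub, singletProj_mul_self]

theorem octetProj_mul_singletProj : octetProj * singletProj = 0 := by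
  simp [octetProj, sub_mul, singletProj_mul_self]

theorem singletProj_add_octetProj : singletProj + octetProj = 1 := by
  simp [octetProj]

theorem trace_octetProj : octetProj.trace = 8 := by
  rw [octetProj, Matrix.trace_sub, trace_singletProj, Matrix.trace_one]
  norm_num

theorem smul_add_smul_pow (x y : ℂ) (n : ℕ) :
    (x • singletProj + y • octetProj) ^ n = x ^ n • singletProj + y ^ n • octetProj := by
  induction n with
  | zero => simp [singletProj_add_octetProj]
  | succ n ih =>
    rw [pow_succ, ih]
    simp only [add_mul, mul_add, smul_mul_smul_comm, singletProj_mul_self, octetProj_mul_self,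
      singletProj_mul_octetProj, octetProj_mul_singletProj, smul_zero, add_zero, zero_add, pow_succ]

end Projections

section HilbertSchmidt

theorem hsInner_eq_sum {L : ℕ} (A B : Op L) :
    hsInner A B = ((3 : ℂ) ^ L)⁻¹ * ∑ s, ∑ t, star (A s t) * B s t := by
  rw [hsInner, Finset.sum_comm]
  simp [Matrix.trace, Matrix.mul_apply, Matrix.conjTranspose_apply]

theorem hsInner_sub_right {L : ℕ} (A B C : Op L) :
    hsInner A (B - C) = hsInner A B - hsInner A C := by
  simp [hsInner, mul_sub]

theorem hsInner_smul_right {L : ℕ} (A B : Op L) (c : ℂ) :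
    hsInner A (c • B) = c * hsInner A B := by
  simp [hsInner]; ring

theorem hsInner_one_left {L : ℕ} (A : Op L) : hsInner 1 A = ((3 : ℂ) ^ L)⁻¹ * A.trace := by
  simp [hsInner]

theorem hsInner_one_one (L : ℕ) : hsInner (1 : Op L) 1 = 1 := by
  simp [hsInner, Matrix.trace_one]

theorem tracelessPart_eq {L : ℕ} (A : Op L) : tracelessPart A = A - hsInner 1 A • (1 : Op L) := by
  rw [tracelessPart, hsInner_one_left]

theorem trace_tracelessPart {L : ℕ} (A : Op L) : (tracelessPart A).trace = 0 := by
  simp [tracelessPart, Matrix.trace_one]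
  field_simp
  simp

theorem hasDerivAt_hsInner {L : ℕ} (B : Op L) {F : ℂ → Op L} {F' : Op L} {u : ℂ}
    (hF : ∀ s t, HasDerivAt (fun v => F v s t) (F' s t) u) :
    HasDerivAt (fun v => hsInner B (F v)) (hsInner B F') u := by
  simp only [hsInner_eq_sum]
  exact HasDerivAt.const_mul _ (HasDerivAt.fun_sum fun s _ => HasDerivAt.fun_sum fun t _ =>
    HasDerivAt.const_mul _ (hF s t))

theorem hsInner_localOp {k : ℕ} (b : Op k) (n : ℕ) (C : Op (k + n)) :
    hsInner (localOp b n) C = ((3 : ℂ) ^ (k + n))⁻¹ * ∑ s, ∑ t, star (b s t) *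
      ∑ r : Fin n → Fin 3, C (Fin.append s r) (Fin.append t r) := by
  rw [hsInner_eq_sum]
  congr 1
  rw [← (Fin.appendEquiv k n).sum_comp, Fintype.sum_prod_type]
  refine Finset.sum_congr rfl fun s _ => ?_
  simp only [← (Fin.appendEquiv k n).sum_comp, Fintype.sum_prod_type]
  rw [Finset.sum_comm]
  refine Finset.sum_congr rfl fun t _ => ?_
  rw [Finset.mul_sum]
  refine Finset.sum_congr rfl fun r _ => ?_
  have h : ∀ (x : Fin k → Fin 3) (y : Fin n → Fin 3), Fin.appendEquiv k n (x, y) = Fin.append x y :=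
    fun _ _ => rfl
  have h1 : ∀ (x : Fin k → Fin 3) (y : Fin n → Fin 3), Fin.append x y ∘ Fin.castAdd n = x :=
    fun x y => funext fun i => Fin.append_left x y i
  have h2 : ∀ (x : Fin k → Fin 3) (y : Fin n → Fin 3), Fin.append x y ∘ Fin.natAdd k = y :=
    fun x y => funext fun i => Fin.append_right x y i
  simp [h, h1, h2, localOp, apply_ite, ite_mul]

theorem hsInner_localOp_one {k : ℕ} (b : Op k) (n : ℕ) :
    hsInner (localOp b n) 1 = hsInner b 1 := by
  rw [hsInner_localOp, hsInner_eq_sum, pow_add, mul_inv, mul_assoc]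
  congr 1
  rw [Finset.mul_sum]
  refine Finset.sum_congr rfl fun s _ => ?_
  rw [Finset.mul_sum]
  refine Finset.sum_congr rfl fun t _ => ?_
  have h : ∀ r : Fin n → Fin 3, (1 : Op (k + n)) (Fin.append s r) (Fin.append t r) =
      (1 : Op k) s t := by
    intro r
    have := (Fin.appendEquiv k n).apply_eq_iff_eq (x := (s, r)) (y := (t, r))
    rw [Prod.mk.injEq, and_iff_left rfl] at this
    simp only [Matrix.one_apply]
    exact if_congr this rfl rfl
  simp only [h, Finset.sum_const, Finset.card_univ, Fintype.card_pi_const, Fintype.card_fin,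
    nsmul_eq_mul, Nat.cast_pow, Nat.cast_ofNat]
  field_simp

end HilbertSchmidt

/-! ### Contracting site matrices and overlaps with local operators -/

/-- The completely positive map `Z ↦ 3⁻¹ ∑ f Z f†` attached to a site matrix. -/
noncomputable def cpMap (f : Fin 3 → Fin 3 → PairOp)
    (Z : PairOp) : PairOp :=
  (3 : ℂ)⁻¹ • ∑ s, ∑ t, f s t * Z * (f s t)ᴴ

/-- The consequences of unitarity and of `SU(3)` symmetry for a site matrix `W v`, with derivative
`W'` at `v = u`, that make the derivative of the matrix product operators of `W v` quasi-local.
The averaged site matrix acts on the singlet and on the octet by `p v` and `q v`, with derivatives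
`p'` and `q'` at `v = u`. The octet blocks contract with rate `lam`, while `gam` and `g` are the
squared norms of the vertices from the octet to the singlet, and from the singlet to the octet by
way of `W'`. -/
structure IsContracting (W : ℂ → Fin 3 → Fin 3 → PairOp)
    (W' : Fin 3 → Fin 3 → PairOp) (u : ℂ)
    (p q : ℂ → ℂ) (p' q' : ℂ) (lam gam g : ℝ) : Prop where
  hasDerivAt : ∀ s t a b, HasDerivAt (fun v => W v s t a b) (W' s t a b) u
  singletProj_mul : ∀ s t, singletProj * W u s t = if s = t then singletProj else 0
  sum_diag : ∀ v, ∑ s, W v s s = (3 : ℂ) • (p v • singletProj + q v • octetProj)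
  trace_singletProj_mul : ∀ v s t, (singletProj * W v s t).trace = if s = t then p v else 0
  hasDerivAt_singlet : HasDerivAt p p' u
  hasDerivAt_octet : HasDerivAt q q' u
  norm_octet_lt : ‖q u‖ < 1
  lam_nonneg : 0 ≤ lam
  lam_lt_one : lam < 1
  gam_pos : 0 < gam
  g_pos : 0 < g
  cpMap_octetProj : cpMap (W u) octetProj = (lam : ℂ) • octetProj
  cpMap_singletProj : cpMap (W u) singletProj = singletProj + (gam : ℂ) • octetProj
  trace_cpMap_deriv : (singletProj * cpMap W' octetProj).trace = g

namespace IsContracting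

variable {W : ℂ → Fin 3 → Fin 3 → PairOp}
  {W' : Fin 3 → Fin 3 → PairOp} {u : ℂ}
  {p q : ℂ → ℂ} {p' q' : ℂ} {lam gam g : ℝ}

theorem singlet_eq_one (h : IsContracting W W' u p q p' q' lam gam g) : p u = 1 := by
  have := h.trace_singletProj_mul u 0 0
  rw [h.singletProj_mul, if_pos rfl, if_pos rfl, trace_singletProj] at this
  exact this.symm

theorem sum_diag_deriv (h : IsContracting W W' u p q p' q' lam gam g) :
    ∑ s, W' s s = (3 : ℂ) • (p' • singletProj + q' • octetProj) := by
  ext a b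
  have h1 : HasDerivAt (fun v => (∑ s, W v s s) a b) ((∑ s, W' s s) a b) u := by
    simp only [Matrix.sum_apply]
    exact HasDerivAt.fun_sum fun s _ => h.hasDerivAt s s a b
  refine h1.unique ?_
  simp only [h.sum_diag, Matrix.smul_apply, Matrix.add_apply, smul_eq_mul]
  exact ((h.hasDerivAt_singlet.mul_const _).add (h.hasDerivAt_octet.mul_const _)).const_mul _

theorem trace_singletProj_mul_deriv (h : IsContracting W W' u p q p' q' lam gam g) (s t : Fin 3) :
    (singletProj * W' s t).trace = if s = t then p' else 0 := by
  have h1 : HasDerivAt (fun v => (singletProj * W v s t).trace) (singletProj * W' s t).trace u :=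
    hasDerivAt_trace fun a b => by
      simp only [Matrix.mul_apply]
      exact HasDerivAt.fun_sum fun c _ => (h.hasDerivAt s t c b).const_mul _
  refine h1.unique ?_
  simp only [h.trace_singletProj_mul]
  split_ifs
  · exact h.hasDerivAt_singlet
  · exact hasDerivAt_const u _

/-- The singlet passes through any number of sites from the left, leaving identities behind. -/
theorem singletProj_mul_prod (h : IsContracting W W' u p q p' q' lam gam g) :
    ∀ {k : ℕ} (s t : Fin k → Fin 3),
      singletProj * (List.ofFn fun j => W u (s j) (t j)).prod = if s = t then singletProj else 0
  | 0, s, t => by simp [Subsingleton.elim s t]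
  | k + 1, s, t => by
    rw [List.ofFn_succ, List.prod_cons, ← mul_assoc, h.singletProj_mul]
    have ih := h.singletProj_mul_prod (fun j => s j.succ) (fun j => t j.succ)
    by_cases h0 : s 0 = t 0
    · rw [if_pos h0, ih]
      refine if_congr ?_ rfl rfl
      simp only [funext_iff, Fin.forall_fin_succ (P := fun j => s j = t j), h0, true_and]
    · rw [if_neg h0, zero_mul, if_neg fun e => h0 (congrFun e 0)]

/-- Summing over the states of the last `n` sites leaves the powers of the two scalars by which the
averaged site matrix acts on the singlet and on the octet. -/
theorem hsInner_localOp_mpo (h : IsContracting W W' u p q p' q' lam gam g) {k : ℕ} (b : Op k)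
    (n : ℕ) (v : ℂ) :
    hsInner (localOp b n) (mpo fun _ => W v) =
      p v ^ n * (((3 : ℂ) ^ k)⁻¹ * ∑ s, ∑ t, star (b s t) *
        ((List.ofFn fun j => W v (s j) (t j)).prod * singletProj).trace) +
      q v ^ n * (((3 : ℂ) ^ k)⁻¹ * ∑ s, ∑ t, star (b s t) *
        ((List.ofFn fun j => W v (s j) (t j)).prod * octetProj).trace) := by
  have key : ∀ s t : Fin k → Fin 3, ∑ r : Fin n → Fin 3,
      mpo (fun _ : Fin (k + n) => W v) (Fin.append s r) (Fin.append t r) =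
      3 ^ n * (p v ^ n * ((List.ofFn fun j => W v (s j) (t j)).prod * singletProj).trace +
        q v ^ n * ((List.ofFn fun j => W v (s j) (t j)).prod * octetProj).trace) := by
    intro s t
    have h1 : ∀ r : Fin n → Fin 3,
        mpo (fun _ : Fin (k + n) => W v) (Fin.append s r) (Fin.append t r) =
        ((List.ofFn fun j => W v (s j) (t j)).prod *
          (List.ofFn fun j => W v (r j) (r j)).prod).trace := by
      intro r
      rw [mpo, Matrix.of_apply, ← List.prod_append, ← List.ofFn_fin_append]
      congr 3
      funext j
      refine Fin.addCases (fun i => ?_) (fun i => ?_) j <;> simp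
    simp only [h1]
    rw [← Matrix.trace_sum, ← Finset.mul_sum, sum_prod_ofFn fun _ x => W v x x, h.sum_diag,
      List.ofFn_const, List.prod_replicate, smul_pow, smul_add_smul_pow]
    simp only [mul_add, Matrix.mul_smul, Matrix.trace_smul, Matrix.trace_add, smul_add, smul_eq_mul]
  rw [hsInner_localOp]
  simp only [key]
  have h3 : ((3 : ℂ) ^ (k + n))⁻¹ * 3 ^ n = ((3 : ℂ) ^ k)⁻¹ := by
    rw [pow_add]; field_simp
  simp only [← h3, Finset.mul_sum, ← Finset.sum_add_distrib]
  refine Finset.sum_congr rfl fun s _ => Finset.sum_congr rfl fun t _ => ?_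
  ring

theorem hsInner_one_mpo (h : IsContracting W W' u p q p' q' lam gam g) (L : ℕ) (v : ℂ) :
    hsInner 1 (mpo fun _ : Fin L => W v) = p v ^ L + 8 * q v ^ L := by
  have h1 : (mpo fun _ : Fin L => W v).trace =
      (∑ s : Fin L → Fin 3, (List.ofFn fun j => W v (s j) (s j)).prod).trace := by
    rw [Matrix.trace_sum]
    rfl
  rw [hsInner_one_left, h1, sum_prod_ofFn fun _ x => W v x x, h.sum_diag,
      List.ofFn_const, List.prod_replicate, smul_pow, smul_add_smul_pow]
  simp only [Matrix.trace_smul, Matrix.trace_add, trace_singletProj, trace_octetProj, smul_eq_mul]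
  field_simp

/-- The overlap is the derivative of that of the matrix product operator of `W v`, which consists of
powers of `p v` and `q v`. The former contribute `p'` per site, which the removal of the trace
cancels, and the powers of the latter vanish in the limit. -/
theorem local_overlap (h : IsContracting W W' u p q p' q' lam gam g) {k : ℕ} (b : Op k) (c : ℂ) :
    ∃ l : ℂ, Filter.Tendsto (fun n : ℕ => hsInner (localOp b n)
      (tracelessPart (c • ∑ i : Fin (k + n), mpo fun j => if j = i then W' else W u)))
      Filter.atTop (nhds l) := by
  set α : ℂ → ℂ := fun v => ((3 : ℂ) ^ k)⁻¹ * ∑ s, ∑ t, star (b s t) *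
        ((List.ofFn fun j => W v (s j) (t j)).prod * singletProj).trace with hα
  set β : ℂ → ℂ := fun v => ((3 : ℂ) ^ k)⁻¹ * ∑ s, ∑ t, star (b s t) *
        ((List.ofFn fun j => W v (s j) (t j)).prod * octetProj).trace with hβ
  have hd : ∀ Z : PairOp, ∃ d, HasDerivAt
      (fun v => ((3 : ℂ) ^ k)⁻¹ * ∑ s, ∑ t, star (b s t) *
        ((List.ofFn fun j => W v (s j) (t j)).prod * Z).trace) d u := by
    intro Z
    refine ⟨_, HasDerivAt.const_mul _ (HasDerivAt.fun_sum fun s _ => HasDerivAt.fun_sum fun t _ =>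
      HasDerivAt.const_mul _ (hasDerivAt_trace (hasDerivAt_mul_apply
        (hasDerivAt_prod_ofFn_apply (F := fun j v => W v (s j) (t j)) fun j => h.hasDerivAt _ _)
        (G := fun _ => Z) (G' := 0) fun a b => hasDerivAt_const u _)))⟩
  obtain ⟨α', hα'⟩ := hd singletProj
  obtain ⟨β', hβ'⟩ := hd octetProj
  have hα1 : α u = hsInner b 1 := by
    simp only [hα, hsInner_eq_sum]
    congr 1
    refine Finset.sum_congr rfl fun s _ => Finset.sum_congr rfl fun t _ => ?_
    rw [Matrix.trace_mul_comm, h.singletProj_mul_prod, Matrix.one_apply]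
    split_ifs <;> simp [trace_singletProj]
  have h1 : ∀ n, hsInner (localOp b n) (∑ i : Fin (k + n), mpo fun j => if j = i then W' else W u) =
      n * p' * hsInner b 1 + α' + (n * q u ^ (n - 1) * q' * β u + q u ^ n * β') := by
    intro n
    refine (hasDerivAt_hsInner (localOp b n) (hasDerivAt_mpo_apply h.hasDerivAt)).unique ?_
    simp only [h.hsInner_localOp_mpo]
    have := ((h.hasDerivAt_singlet.pow n).mul hα').add ((h.hasDerivAt_octet.pow n).mul hβ')
    refine this.congr_deriv ?_
    rw [← hα1]
    simp only [h.singlet_eq_one, one_pow, mul_one, one_mul, Pi.pow_apply]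
    rfl
  have h2 : ∀ L, hsInner 1 (∑ i : Fin L, mpo fun j => if j = i then W' else W u) =
      L * p' + 8 * (L * q u ^ (L - 1) * q') := by
    intro L
    refine (hasDerivAt_hsInner 1 (hasDerivAt_mpo_apply h.hasDerivAt)).unique ?_
    simp only [h.hsInner_one_mpo]
    have := (h.hasDerivAt_singlet.pow L).add ((h.hasDerivAt_octet.pow L).const_mul 8)
    refine this.congr_deriv ?_
    simp only [h.singlet_eq_one, one_pow, mul_one]
  have t1 : Filter.Tendsto (fun n : ℕ => q u ^ n) Filter.atTop (nhds 0) :=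
    tendsto_pow_atTop_nhds_zero_of_norm_lt_one h.norm_octet_lt
  have t2 : Filter.Tendsto (fun n : ℕ => n * q u ^ (n - 1)) Filter.atTop (nhds 0) := by
    rw [← Filter.tendsto_add_atTop_iff_nat 1]
    have t0 : Filter.Tendsto (fun n : ℕ => n * q u ^ n) Filter.atTop (nhds 0) := by
      rw [tendsto_zero_iff_norm_tendsto_zero]
      simpa using tendsto_self_mul_const_pow_of_lt_one (norm_nonneg _) h.norm_octet_lt
    have := t0.add t1
    rw [add_zero] at this
    refine this.congr fun n => ?_
    simp; ring
  have t3 := t2.comp (Filter.tendsto_add_atTop_nat k)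
  refine ⟨c * (α' - k * p' * hsInner b 1), ?_⟩
  have t4 := ((((t2.mul_const (q' * β u)).add (t1.mul_const β')).sub
    (t3.mul_const (8 * q' * hsInner b 1))).const_add (α' - k * p' * hsInner b 1)).const_mul c
  simp only [zero_mul, add_zero, sub_zero] at t4
  refine t4.congr fun n => ?_
  rw [tracelessPart_eq, hsInner_sub_right, hsInner_smul_right, hsInner_smul_right,
    hsInner_smul_right, hsInner_localOp_one, h1, h2]
  simp only [Function.comp_apply, add_comm n k]
  push_cast
  ring

end IsContracting

/-! ### The Hilbert-Schmidt norm, translates and averages over the states -/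

section HilbertSchmidtNorm

theorem hsInner_add_left {L : ℕ} (A B C : Op L) :
    hsInner (A + B) C = hsInner A C + hsInner B C := by
  simp [hsInner, add_mul, mul_add]

theorem hsInner_add_right {L : ℕ} (A B C : Op L) :
    hsInner A (B + C) = hsInner A B + hsInner A C := by
  simp [hsInner, mul_add]

theorem star_hsInner {L : ℕ} (A B : Op L) : star (hsInner A B) = hsInner B A := by
  simp [hsInner_eq_sum, mul_comm]

theorem hsInner_sum_left {L : ℕ} {κ : Type*} (I : Finset κ) (F : κ → Op L) (C : Op L) :
    hsInner (∑ i ∈ I, F i) C = ∑ i ∈ I, hsInner (F i) C := by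
  simp [hsInner, Matrix.conjTranspose_sum, Finset.sum_mul, Matrix.trace_sum, Finset.mul_sum]

theorem hsInner_sum_right {L : ℕ} {κ : Type*} (I : Finset κ) (F : κ → Op L) (C : Op L) :
    hsInner C (∑ i ∈ I, F i) = ∑ i ∈ I, hsInner C (F i) := by
  simp [hsInner, Finset.mul_sum, Matrix.trace_sum]

theorem hsInner_sum_self {L : ℕ} {κ : Type*} (I : Finset κ) (F : κ → Op L)
    (h : ∀ i ∈ I, ∀ j ∈ I, i ≠ j → hsInner (F i) (F j) = 0) :
    hsInner (∑ i ∈ I, F i) (∑ i ∈ I, F i) = ∑ i ∈ I, hsInner (F i) (F i) := by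
  rw [hsInner_sum_left]
  refine Finset.sum_congr rfl fun i hi => ?_
  rw [hsInner_sum_right]
  exact Finset.sum_eq_single_of_mem i hi fun j hj hji => h i hi j hj hji.symm

theorem hsNormSq_eq_sum {L : ℕ} (A : Op L) :
    hsNormSq A = ((3 : ℝ) ^ L)⁻¹ * ∑ s, ∑ t, ‖A s t‖ ^ 2 := by
  have h : hsInner A A = ((((3 : ℝ) ^ L)⁻¹ * ∑ s, ∑ t, ‖A s t‖ ^ 2 : ℝ) : ℂ) := by
    rw [hsInner_eq_sum]
    push_cast
    congr! 4 with s _ t _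
    exact Complex.conj_mul' _
  rw [hsNormSq, h, Complex.ofReal_re]

theorem hsNormSq_nonneg {L : ℕ} (A : Op L) : 0 ≤ hsNormSq A := by
  rw [hsNormSq_eq_sum]
  positivity

/-- The Hilbert-Schmidt norm. -/
noncomputable def hsNorm {L : ℕ} (A : Op L) : ℝ := √(hsNormSq A)

theorem hsNorm_sq {L : ℕ} (A : Op L) : hsNorm A ^ 2 = hsNormSq A :=
  Real.sq_sqrt (hsNormSq_nonneg A)

theorem hsNorm_eq_norm {L : ℕ} (A : Op L) :
    hsNorm A = √((3 : ℝ) ^ L)⁻¹ *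
      ‖(WithLp.toLp 2 fun x => A x.1 x.2 :
        EuclideanSpace ℂ ((Fin L → Fin 3) × (Fin L → Fin 3)))‖ := by
  rw [hsNorm, hsNormSq_eq_sum, Real.sqrt_mul (by positivity), EuclideanSpace.norm_eq,
    Fintype.sum_prod_type]

theorem hsNorm_add_le {L : ℕ} (A B : Op L) : hsNorm (A + B) ≤ hsNorm A + hsNorm B := by
  simp only [hsNorm_eq_norm, ← mul_add]
  gcongr
  exact norm_add_le (WithLp.toLp 2 fun x : (Fin L → Fin 3) × (Fin L → Fin 3) => A x.1 x.2)
    (WithLp.toLp 2 fun x : (Fin L → Fin 3) × (Fin L → Fin 3) => B x.1 x.2)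

theorem hsNorm_zero {L : ℕ} : hsNorm (0 : Op L) = 0 := by
  simp [hsNorm, hsNormSq, hsInner]

theorem hsNorm_sum_le {L : ℕ} {κ : Type*} (I : Finset κ) (F : κ → Op L) :
    hsNorm (∑ i ∈ I, F i) ≤ ∑ i ∈ I, hsNorm (F i) :=
  Finset.le_sum_of_subadditive hsNorm hsNorm_zero.le hsNorm_add_le I F

theorem hsNormSq_smul {L : ℕ} (c : ℂ) (A : Op L) : hsNormSq (c • A) = ‖c‖ ^ 2 * hsNormSq A := by
  simp only [hsNormSq_eq_sum, Matrix.smul_apply, smul_eq_mul, norm_mul, mul_pow, Finset.mul_sum]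
  refine Finset.sum_congr rfl fun s _ => Finset.sum_congr rfl fun t _ => ?_
  ring

theorem hsNormSq_tracelessPart_le {L : ℕ} (A : Op L) : hsNormSq (tracelessPart A) ≤ hsNormSq A := by
  have h1 : A = tracelessPart A + hsInner 1 A • (1 : Op L) := by rw [tracelessPart_eq]; abel
  have h2 : hsInner (tracelessPart A) 1 = 0 := by
    rw [← star_hsInner, hsInner_one_left, trace_tracelessPart, mul_zero, star_zero]
  have h4 : hsNormSq A = hsNormSq (tracelessPart A) + hsNormSq (hsInner 1 A • (1 : Op L)) := by
    conv_lhs => rw [h1, hsNormSq]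
    have h5 : hsInner (hsInner 1 A • (1 : Op L)) (tracelessPart A) = 0 := by
      rw [← star_hsInner, hsInner_smul_right, h2, mul_zero, star_zero]
    rw [hsInner_add_left, hsInner_add_right, hsInner_add_right, h5, hsInner_smul_right _ 1, h2]
    simp [hsNormSq]
  rw [h4]
  exact le_add_of_nonneg_right (hsNormSq_nonneg _)

end HilbertSchmidtNorm

section Shift

/-- The translate by `k` sites of an operator on a ring of `n + 1` sites. -/
def shiftOp {n : ℕ} (k : Fin (n + 1)) (A : Op (n + 1)) : Op (n + 1) :=
  A.submatrix (fun s j => s (j + k)) (fun s j => s (j + k))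

theorem hsInner_shiftOp {n : ℕ} (k : Fin (n + 1)) (A B : Op (n + 1)) :
    hsInner (shiftOp k A) (shiftOp k B) = hsInner A B := by
  have e : ∀ F : (Fin (n + 1) → Fin 3) → ℂ,
      ∑ s : Fin (n + 1) → Fin 3, F (fun j => s (j + k)) = ∑ s, F s := fun F =>
    ((Equiv.addRight k).symm.arrowCongr (Equiv.refl (Fin 3))).sum_comp F
  simp only [hsInner_eq_sum, shiftOp, Matrix.submatrix_apply]
  rw [← e fun s => ∑ t, star (A s t) * B s t]
  congr 1
  refine Finset.sum_congr rfl fun s _ => ?_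
  exact e fun t => star (A (fun j => s (j + k)) t) * B (fun j => s (j + k)) t

theorem hsNorm_shiftOp {n : ℕ} (k : Fin (n + 1)) (A : Op (n + 1)) :
    hsNorm (shiftOp k A) = hsNorm A := by
  rw [hsNorm, hsNorm, hsNormSq, hsNormSq, hsInner_shiftOp]

theorem shiftOp_add {n : ℕ} (k : Fin (n + 1)) (A B : Op (n + 1)) :
    shiftOp k (A + B) = shiftOp k A + shiftOp k B := rfl

theorem shiftOp_smul {n : ℕ} (k : Fin (n + 1)) (c : ℂ) (A : Op (n + 1)) :
    shiftOp k (c • A) = c • shiftOp k A := rfl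

theorem shiftOp_one {n : ℕ} (k : Fin (n + 1)) : shiftOp k (1 : Op (n + 1)) = 1 :=
  Matrix.submatrix_one _ ((Equiv.addRight k).symm.arrowCongr (Equiv.refl (Fin 3))).injective

theorem shiftOp_sum {n : ℕ} {κ : Type*} (k : Fin (n + 1)) (I : Finset κ) (F : κ → Op (n + 1)) :
    shiftOp k (∑ i ∈ I, F i) = ∑ i ∈ I, shiftOp k (F i) := by
  ext s t
  simp [shiftOp, Matrix.sum_apply]

variable {ι : Type*} [Fintype ι] [DecidableEq ι]

theorem shiftOp_mpo {n : ℕ} (k : Fin (n + 1)) (f : Fin (n + 1) → Fin 3 → Fin 3 → Matrix ι ι ℂ) :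
    shiftOp k (mpo f) = mpo fun j => f (j - k) := by
  ext s t
  simp only [shiftOp, mpo, Matrix.submatrix_apply, Matrix.of_apply]
  rw [← trace_prod_ofFn_add (fun j => f (j - k) (s j) (t j)) k]
  simp only [add_sub_cancel_right]

/-- Matrix product operators are orthogonal if at some site the first one acts as the identity,
while the second one has vanishing partial trace there. -/
theorem hsInner_mpo_eq_zero {L : ℕ} {f g : Fin L → Fin 3 → Fin 3 → Matrix ι ι ℂ} (j : Fin L)
    {F : Matrix ι ι ℂ} (hf : ∀ s t, f j s t = if s = t then F else 0)
    (hg : ∑ s, g j s s = 0) : hsInner (mpo f) (mpo g) = 0 := by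
  have h1 : ∀ s t : Fin L → Fin 3, star (mpo f s t) * mpo g s t =
      (List.ofFn fun i =>
        Matrix.kronecker ((f i (s i) (t i)).map star) (g i (s i) (t i))).prod.trace := by
    intro s t
    rw [mpo, mpo, Matrix.of_apply, Matrix.of_apply, star_trace_prod_ofFn, ← Matrix.trace_kronecker,
      ← kronecker_prod_ofFn]
    rfl
  rw [hsInner_eq_sum]
  simp only [h1, ← Matrix.trace_sum]
  have h2 : ∀ s : Fin L → Fin 3, ∑ t : Fin L → Fin 3, (List.ofFn fun i =>
      Matrix.kronecker ((f i (s i) (t i)).map star) (g i (s i) (t i))).prod =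
      (List.ofFn fun i => ∑ y, Matrix.kronecker ((f i (s i) y).map star) (g i (s i) y)).prod :=
    fun s => sum_prod_ofFn fun i y => Matrix.kronecker ((f i (s i) y).map star) (g i (s i) y)
  simp only [h2]
  rw [sum_prod_ofFn fun i x => ∑ y, Matrix.kronecker ((f i x y).map star) (g i x y),
    List.prod_eq_zero, Matrix.trace_zero, mul_zero]
  rw [List.mem_ofFn]
  refine ⟨j, ?_⟩
  have h3 : ∀ x y, Matrix.kronecker ((f j x y).map star) (g j x y) =
      if x = y then Matrix.kronecker (F.map star) (g j x x) else 0 := by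
    intro x y
    rw [hf]
    split_ifs with h
    · rw [h]
    · ext
      simp [Matrix.kroneckerMap_apply]
  simp only [h3, Finset.sum_ite_eq, Finset.mem_univ, if_true]
  have h4 : ∑ x, Matrix.kronecker (F.map star) (g j x x) =
      Matrix.kronecker (F.map star) (∑ x, g j x x) := by
    ext
    simp [Matrix.kroneckerMap_apply, Matrix.sum_apply, Finset.mul_sum]
  rw [h4, hg]
  ext
  simp [Matrix.kroneckerMap_apply]

end Shift

section Average

variable (f : Fin 3 → Fin 3 → PairOp)

theorem cpMap_smul (c : ℂ) (Z : PairOp) :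
    cpMap f (c • Z) = c • cpMap f Z := by
  simp only [cpMap, Matrix.mul_smul, Matrix.smul_mul, ← Finset.smul_sum, smul_comm c]

theorem cpMap_mul_mul (X Y Z : PairOp) :
    cpMap (fun s t => X * f s t * Y) Z = X * cpMap f (Y * Z * Yᴴ) * Xᴴ := by
  simp only [cpMap, Matrix.mul_smul, Matrix.smul_mul, Finset.mul_sum, Finset.sum_mul,
    Matrix.conjTranspose_mul, mul_assoc]

/-- The sum of `F * Z * F†` over all pairs of states, divided by `3 ^ L`, where `F` is the ordered
product of the site matrices `f j`. -/
noncomputable def avgMap {L : ℕ}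
    (f : Fin L → Fin 3 → Fin 3 → PairOp)
    (Z : PairOp) : PairOp :=
  ((3 : ℂ) ^ L)⁻¹ • ∑ s : Fin L → Fin 3, ∑ t : Fin L → Fin 3,
    (List.ofFn fun j => f j (s j) (t j)).prod * Z * (List.ofFn fun j => f j (s j) (t j)).prodᴴ

theorem avgMap_zero (f : Fin 0 → Fin 3 → Fin 3 → PairOp)
    (Z : PairOp) : avgMap f Z = Z := by
  simp [avgMap]

theorem avgMap_succ {L : ℕ}
    (f : Fin (L + 1) → Fin 3 → Fin 3 → PairOp)
    (Z : PairOp) :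
    avgMap f Z = cpMap (f 0) (avgMap (fun j => f j.succ) Z) := by
  have e : ∀ F : (Fin (L + 1) → Fin 3) → PairOp,
      ∑ s, F s = ∑ x, ∑ s : Fin L → Fin 3, F (Fin.cons x s) := by
    intro F
    rw [← (Fin.consEquiv fun _ : Fin (L + 1) => Fin 3).sum_comp, Fintype.sum_prod_type]
    rfl
  simp only [avgMap, cpMap, e, List.ofFn_succ, Fin.cons_zero, Fin.cons_succ, List.prod_cons,
    Matrix.conjTranspose_mul, Matrix.mul_smul, Matrix.smul_mul, Finset.mul_sum, Finset.sum_mul,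
    ← Finset.smul_sum, smul_smul, pow_succ', mul_inv, mul_assoc]
  congr 1
  exact Finset.sum_congr rfl fun x _ => Finset.sum_comm

end Average

/-! ### Decomposition of the charge density into strings -/

/-- The site matrices of a string in the octet: `m` sites in the octet, the vertex to the singlet,
and identities afterwards. -/
noncomputable def stringTail (f : Fin 3 → Fin 3 → PairOp)
    (m i : ℕ) (s t : Fin 3) : PairOp :=
  if i < m then f s t * octetProj
  else if i = m then octetProj * f s t * singletProj
  else if s = t then singletProj else 0

/-- The site matrices of a string that starts at the first site, with the vertex `f'` from the
singlet to the octet. -/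
noncomputable def stringSite (f f' : Fin 3 → Fin 3 → PairOp)
    (n m : ℕ) : Fin (n + 1) → Fin 3 → Fin 3 → PairOp :=
  Fin.cons (fun s t => singletProj * f' s t * octetProj) fun i => stringTail f m i

/-- The string that starts at the first site and stays in the octet for `m` sites. For `m < n` it
acts as the identity on all but the first `m + 2` sites. -/
noncomputable def stringOp (f f' : Fin 3 → Fin 3 → PairOp)
    (n m : ℕ) : Op (n + 1) :=
  mpo (stringSite f f' n m)

/-- The part of the charge density at the first site that stays in the octet all around the ring. -/
noncomputable def windingOp (f f' : Fin 3 → Fin 3 → PairOp)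
    (n : ℕ) : Op (n + 1) :=
  mpo (Fin.cons (fun s t => octetProj * f' s t) fun _ s t => f s t * octetProj)

theorem singletProj_mul_prod_ite : ∀ {n : ℕ} (s t : Fin n → Fin 3),
    singletProj * (List.ofFn fun i => if s i = t i then singletProj else 0).prod =
      if s = t then singletProj else 0
  | 0, s, t => by simp [Subsingleton.elim s t]
  | n + 1, s, t => by
    rw [List.ofFn_succ, List.prod_cons]
    by_cases h0 : s 0 = t 0
    · rw [if_pos h0, singletProj_mul_prod_ite (fun i => s i.succ) fun i => t i.succ, mul_ite,
        mul_zero, singletProj_mul_self]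
      refine if_congr ?_ rfl rfl
      simp only [funext_iff, Fin.forall_fin_succ (P := fun j => s j = t j), h0, true_and]
    · rw [if_neg h0, zero_mul, mul_zero, if_neg fun e => h0 (congrFun e 0)]

theorem avgMap_ite (n : ℕ) :
    avgMap (fun (_ : Fin n) s t => if s = t then singletProj else 0) singletProj =
      singletProj := by
  induction n with
  | zero => exact avgMap_zero _ _
  | succ n ih =>
    rw [avgMap_succ, ih, cpMap]
    have h : ∀ s t : Fin 3, (if s = t then singletProj else 0) * singletProj *
        (if s = t then singletProj else 0)ᴴ = if s = t then singletProj else 0 := by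
      intro s t
      split_ifs <;> simp [conjTranspose_singletProj, singletProj_mul_self]
    simp only [h, Finset.sum_ite_eq, Finset.mem_univ, if_true, Finset.sum_const, Finset.card_univ,
      Fintype.card_fin]
    rw [← Nat.cast_smul_eq_nsmul ℂ, smul_smul]
    norm_num

/-- The Cauchy-Schwarz inequality for a trace over the nine dimensional auxiliary space. -/
theorem norm_trace_sq_le (Y : PairOp) :
    ‖Y.trace‖ ^ 2 ≤ 9 * (Y * Yᴴ).trace.re := by
  have h1 : (Y * Yᴴ).trace.re = ∑ i, ∑ j, ‖Y i j‖ ^ 2 := by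
    simp only [Matrix.trace, Matrix.diag, Matrix.mul_apply, Matrix.conjTranspose_apply,
      Complex.re_sum]
    refine Finset.sum_congr rfl fun i _ => Finset.sum_congr rfl fun j _ => ?_
    rw [Complex.star_def, Complex.mul_conj']
    norm_cast
  calc ‖Y.trace‖ ^ 2 ≤ (∑ i, ‖Y i i‖) ^ 2 := by
        gcongr
        exact norm_sum_le _ _
    _ ≤ 9 * ∑ i, ‖Y i i‖ ^ 2 := by
        have := sq_sum_le_card_mul_sum_sq (s := Finset.univ) (f := fun i => ‖Y i i‖)
        simpa using this
    _ ≤ 9 * (Y * Yᴴ).trace.re := by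
        rw [h1]
        gcongr with i
        exact Finset.single_le_sum (f := fun j => ‖Y i j‖ ^ 2) (fun j _ => by positivity)
          (Finset.mem_univ i)

namespace IsContracting

variable {W : ℂ → Fin 3 → Fin 3 → PairOp}
  {W' : Fin 3 → Fin 3 → PairOp} {u : ℂ}
  {p q : ℂ → ℂ} {p' q' : ℂ} {lam gam g : ℝ}

theorem octetProj_mul_mul_octetProj (h : IsContracting W W' u p q p' q' lam gam g) (s t : Fin 3) :
    octetProj * (W u s t * octetProj) = W u s t * octetProj := by
  rw [octetProj, sub_mul, one_mul, ← octetProj, ← mul_assoc, h.singletProj_mul]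
  split_ifs <;> simp [singletProj_mul_octetProj]

theorem octetProj_mul_stringTail (h : IsContracting W W' u p q p' q' lam gam g) {n m : ℕ}
    (hm : m < n) (s t : Fin n → Fin 3) :
    octetProj * (List.ofFn fun i => stringTail (W u) m i (s i) (t i)).prod =
      (List.ofFn fun i : Fin n => stringTail (W u) m i (s i) (t i)).prod := by
  obtain ⟨k, rfl⟩ : ∃ k, n = k + 1 := ⟨n - 1, by omega⟩
  rw [List.ofFn_succ, List.prod_cons, ← mul_assoc]
  congr 1
  rcases Nat.eq_zero_or_pos m with rfl | h0
  · simp [stringTail, ← mul_assoc, octetProj_mul_self]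
  · have e : stringTail (W u) m (0 : Fin (k + 1)) (s 0) (t 0) = W u (s 0) (t 0) * octetProj := by
      simp [stringTail, h0]
    rw [e]
    exact h.octetProj_mul_mul_octetProj _ _

theorem stringTail_mul_singletProj {f : Fin 3 → Fin 3 → PairOp} :
    ∀ {n m : ℕ} (_ : m < n) (s t : Fin n → Fin 3),
      (List.ofFn fun i => stringTail f m i (s i) (t i)).prod * singletProj =
      (List.ofFn fun i : Fin n => stringTail f m i (s i) (t i)).prod
  | 0, m, hm, s, t => absurd hm (Nat.not_lt_zero m)
  | n + 1, 0, _, s, t => by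
    rw [List.ofFn_succ, List.prod_cons]
    simp only [stringTail, Fin.val_zero, Fin.val_succ, lt_self_iff_false, if_false, if_true,
      Nat.not_lt_zero, Nat.succ_ne_zero]
    rw [mul_assoc _ singletProj, singletProj_mul_prod_ite (fun i => s i.succ) fun i => t i.succ,
      mul_assoc]
    split_ifs <;> simp [singletProj_mul_self]
  | n + 1, m + 1, hm, s, t => by
    have ih := stringTail_mul_singletProj (f := f) (Nat.lt_of_succ_lt_succ hm) (fun i => s i.succ)
      fun i => t i.succ
    rw [List.ofFn_succ, List.prod_cons]
    have e : ∀ (i : ℕ), stringTail f (m + 1) (i + 1) = stringTail f m i := by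
      intro i
      funext s t
      simp [stringTail]
    simp only [Fin.val_succ, e]
    rw [mul_assoc, ih]

theorem octetProj_mul_octet_prod (h : IsContracting W W' u p q p' q' lam gam g) {n : ℕ}
    (s t : Fin n → Fin 3) :
    octetProj * ((List.ofFn fun i => W u (s i) (t i) * octetProj).prod * octetProj) =
      (List.ofFn fun i => W u (s i) (t i) * octetProj).prod * octetProj := by
  cases n with
  | zero => simp [octetProj_mul_self]
  | succ n =>
    rw [List.ofFn_succ, List.prod_cons, ← mul_assoc, ← mul_assoc, h.octetProj_mul_mul_octetProj]

/-- The site matrices are block triangular: once the singlet is entered from the left, only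
identities follow. Hence an ordered product is the sum of the identity, of the strings that
enter the singlet at the site `m`, and of the product of the octet blocks. -/
theorem prod_eq_strings (h : IsContracting W W' u p q p' q' lam gam g) :
    ∀ {n : ℕ} (s t : Fin n → Fin 3),
      (List.ofFn fun i => W u (s i) (t i)).prod =
        (if s = t then singletProj else 0) +
        ∑ m ∈ Finset.range n, (List.ofFn fun i : Fin n => stringTail (W u) m i (s i) (t i)).prod +
        (List.ofFn fun i => W u (s i) (t i) * octetProj).prod * octetProj
  | 0, s, t => by simp [Subsingleton.elim s t, singletProj_add_octetProj]
  | n + 1, s, t => by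
    have ih := h.prod_eq_strings (fun i => s i.succ) fun i => t i.succ
    have e : ∀ m (i : ℕ), stringTail (W u) (m + 1) (i + 1) = stringTail (W u) m i := by
      intro m i
      funext s t
      simp [stringTail]
    have h0 : ∀ i : ℕ, stringTail (W u) 0 (i + 1) =
        fun s t => if s = t then singletProj else 0 := by
      intro i
      funext s t
      simp [stringTail]
    have h1 : W u (s 0) (t 0) * singletProj = (if s 0 = t 0 then singletProj else 0) +
        octetProj * W u (s 0) (t 0) * singletProj := by
      conv_lhs => rw [← one_mul (W u (s 0) (t 0)), ← singletProj_add_octetProj, add_mul, add_mul,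
        h.singletProj_mul, ite_mul, singletProj_mul_self, zero_mul]
    have h2 : ∀ m ∈ Finset.range n, W u (s 0) (t 0) *
        (List.ofFn fun i : Fin n => stringTail (W u) m i (s i.succ) (t i.succ)).prod =
        W u (s 0) (t 0) * octetProj *
        (List.ofFn fun i : Fin n => stringTail (W u) m i (s i.succ) (t i.succ)).prod := by
      intro m hm
      rw [mul_assoc, h.octetProj_mul_stringTail (Finset.mem_range.1 hm)]
    have h3 : (if s = t then singletProj else 0) = (if s 0 = t 0 then singletProj else 0) *
        if (fun i : Fin n => s i.succ) = (fun i => t i.succ) then singletProj else 0 := by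
      rw [mul_ite, mul_zero, ite_mul, singletProj_mul_self, zero_mul, ← ite_and]
      refine if_congr ?_ rfl rfl
      simp only [funext_iff, Fin.forall_fin_succ (P := fun j => s j = t j)]
      exact and_comm
    have h4 : ∀ Y, Y * singletProj * (List.ofFn fun i : Fin n =>
        if s i.succ = t i.succ then singletProj else 0).prod = Y *
        if (fun i : Fin n => s i.succ) = (fun i => t i.succ) then singletProj else 0 := by
      intro Y
      rw [mul_assoc, singletProj_mul_prod_ite (fun i => s i.succ) fun i => t i.succ]
    have h5 : W u (s 0) (t 0) *
        (if (fun i : Fin n => s i.succ) = (fun i => t i.succ) then singletProj else 0) =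
        (W u (s 0) (t 0) * singletProj) *
        (if (fun i : Fin n => s i.succ) = (fun i => t i.succ) then singletProj else 0) := by
      split_ifs <;> simp [mul_assoc, singletProj_mul_self]
    have h6 : octetProj * W u (s 0) (t 0) * singletProj *
        (if (fun i : Fin n => s i.succ) = (fun i => t i.succ) then singletProj else 0) =
        octetProj * W u (s 0) (t 0) *
        (if (fun i : Fin n => s i.succ) = (fun i => t i.succ) then singletProj else 0) := by
      split_ifs <;> simp [mul_assoc, singletProj_mul_self]
    rw [List.ofFn_succ, List.prod_cons, ih, Finset.sum_range_succ']
    simp only [List.ofFn_succ, List.prod_cons, Fin.val_succ, e, h0, Fin.val_zero]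
    have e0 : ∀ m, stringTail (W u) (m + 1) 0 (s 0) (t 0) = W u (s 0) (t 0) * octetProj := by
      intro m
      simp [stringTail]
    have e1 : stringTail (W u) 0 0 (s 0) (t 0) = octetProj * W u (s 0) (t 0) * singletProj := by
      simp [stringTail]
    rw [mul_add, mul_add, h5, h1, add_mul, ← h3, Finset.mul_sum, Finset.sum_congr rfl h2,
      ← h.octetProj_mul_octet_prod, h6]
    simp only [e0, e1, h4, mul_assoc]
    abel

/-- The density of the charge: besides a scalar it consists of strings that start at the first
site, and of the winding term. -/
theorem density_eq (h : IsContracting W W' u p q p' q' lam gam g) (n : ℕ) :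
    (mpo fun j : Fin (n + 1) => if j = 0 then W' else W u) =
      p' • (1 : Op (n + 1)) + ∑ m ∈ Finset.range n, stringOp (W u) W' n m +
        windingOp (W u) W' n := by
  ext s t
  have h0 : mpo (fun j : Fin (n + 1) => if j = 0 then W' else W u) s t =
      (W' (s 0) (t 0) * (List.ofFn fun i : Fin n => W u (s i.succ) (t i.succ)).prod).trace := by
    simp [mpo, List.ofFn_succ]
  rw [h0, h.prod_eq_strings (fun i => s i.succ) fun i => t i.succ]
  rw [mul_add, mul_add, Matrix.trace_add, Matrix.trace_add, Matrix.add_apply, Matrix.add_apply]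
  congr 1
  · congr 1
    · rw [mul_ite, mul_zero, Matrix.smul_apply, Matrix.one_apply]
      have h1 := h.trace_singletProj_mul_deriv (s 0) (t 0)
      rw [Matrix.trace_mul_comm] at h1
      have h2 : s = t ↔ (fun i : Fin n => s i.succ) = (fun i => t i.succ) ∧ s 0 = t 0 := by
        simp only [funext_iff, Fin.forall_fin_succ (P := fun j => s j = t j)]
        exact and_comm
      simp only [h2, ite_and]
      split_ifs <;> simp_all
    · rw [Finset.mul_sum, Matrix.trace_sum, Matrix.sum_apply]
      refine Finset.sum_congr rfl fun m hm => ?_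
      rw [← h.octetProj_mul_stringTail (Finset.mem_range.1 hm),
        ← stringTail_mul_singletProj (Finset.mem_range.1 hm), ← mul_assoc, ← mul_assoc,
        Matrix.trace_mul_comm]
      simp [stringOp, mpo, stringSite, List.ofFn_succ, mul_assoc]
  · rw [← mul_assoc, Matrix.trace_mul_comm]
    simp [windingOp, mpo, List.ofFn_succ, mul_assoc]

end IsContracting

/-! ### Norms and orthogonality of strings -/

theorem sqrt_pow_of_nonneg {x : ℝ} (hx : 0 ≤ x) (n : ℕ) : √(x ^ n) = √x ^ n := by
  have h : x ^ n = (√x ^ n) ^ 2 := by rw [← pow_mul, mul_comm, pow_mul, Real.sq_sqrt hx]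
  rw [h, Real.sqrt_sq (by positivity)]

/-- If the ordered products begin and end in the singlet, they are multiples of `singletProj`,
so the squared norm is the trace of an average of `singletProj`. -/
theorem hsInner_mpo_self {L : ℕ}
    {f : Fin L → Fin 3 → Fin 3 → PairOp}
    (hf : ∀ s t : Fin L → Fin 3, singletProj * (List.ofFn fun j => f j (s j) (t j)).prod *
      singletProj = (List.ofFn fun j => f j (s j) (t j)).prod) :
    hsInner (mpo f) (mpo f) = (avgMap f singletProj).trace := by
  rw [hsInner_eq_sum, avgMap, Matrix.trace_smul, smul_eq_mul, Matrix.trace_sum]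
  congr 1
  refine Finset.sum_congr rfl fun s _ => ?_
  rw [Matrix.trace_sum]
  refine Finset.sum_congr rfl fun t _ => ?_
  rw [mpo, Matrix.of_apply]
  generalize hY : (List.ofFn fun j => f j (s j) (t j)).prod = Y
  have h1 := hf s t
  rw [hY, singletProj_mul_mul_self] at h1
  rw [← h1]
  simp [Matrix.trace_smul, trace_singletProj, conjTranspose_singletProj, singletProj_mul_self]

namespace IsContracting

variable {W : ℂ → Fin 3 → Fin 3 → PairOp}
  {W' : Fin 3 → Fin 3 → PairOp} {u : ℂ}
  {p q : ℂ → ℂ} {p' q' : ℂ} {lam gam g : ℝ}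

theorem cpMap_octet (h : IsContracting W W' u p q p' q' lam gam g) :
    cpMap (fun s t => W u s t * octetProj) octetProj = (lam : ℂ) • octetProj := by
  have := cpMap_mul_mul (W u) 1 octetProj octetProj
  simpa [conjTranspose_octetProj, octetProj_mul_self, h.cpMap_octetProj] using this

theorem cpMap_exit (h : IsContracting W W' u p q p' q' lam gam g) :
    cpMap (fun s t => octetProj * W u s t * singletProj) singletProj = (gam : ℂ) • octetProj := by
  rw [cpMap_mul_mul, conjTranspose_singletProj, singletProj_mul_self, singletProj_mul_self,
    h.cpMap_singletProj, conjTranspose_octetProj, mul_add, octetProj_mul_singletProj, zero_add,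
    mul_smul_comm, octetProj_mul_self, smul_mul_assoc, octetProj_mul_self]

theorem avgMap_stringTail (h : IsContracting W W' u p q p' q' lam gam g) :
    ∀ {n m : ℕ} (_ : m < n), avgMap (fun i : Fin n => stringTail (W u) m i) singletProj =
      ((lam : ℂ) ^ m * gam) • octetProj
  | 0, m, hm => absurd hm (Nat.not_lt_zero m)
  | n + 1, 0, _ => by
    have e0 : stringTail (W u) 0 (0 : Fin (n + 1)) =
        fun s t => octetProj * W u s t * singletProj := by
      funext s t
      simp [stringTail]
    have e1 : (fun i : Fin n => stringTail (W u) 0 i.succ) =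
        fun _ s t => if s = t then singletProj else 0 := by
      funext i s t
      simp [stringTail]
    rw [avgMap_succ, e0, e1, avgMap_ite, h.cpMap_exit, pow_zero, one_mul]
  | n + 1, m + 1, hm => by
    have e0 : stringTail (W u) (m + 1) (0 : Fin (n + 1)) = fun s t => W u s t * octetProj := by
      funext s t
      simp [stringTail]
    have e1 : (fun i : Fin n => stringTail (W u) (m + 1) i.succ) =
        fun i : Fin n => stringTail (W u) m i := by
      funext i s t
      simp [stringTail]
    rw [avgMap_succ, e0, e1, h.avgMap_stringTail (Nat.lt_of_succ_lt_succ hm), cpMap_smul,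
      h.cpMap_octet, smul_smul]
    congr 1
    ring

theorem hsInner_stringOp_self (h : IsContracting W W' u p q p' q' lam gam g) {n m : ℕ}
    (hm : m < n) :
    hsInner (stringOp (W u) W' n m) (stringOp (W u) W' n m) = ((g * gam * lam ^ m : ℝ) : ℂ) := by
  rw [stringOp, hsInner_mpo_self, avgMap_succ]
  · have e0 : stringSite (W u) W' n m 0 = fun s t => singletProj * W' s t * octetProj := rfl
    have e1 : (fun i : Fin n => stringSite (W u) W' n m i.succ) =
        fun i : Fin n => stringTail (W u) m i := rfl
    rw [e0, e1, h.avgMap_stringTail hm, cpMap_smul, cpMap_mul_mul, conjTranspose_octetProj,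
      octetProj_mul_self, octetProj_mul_self, conjTranspose_singletProj, Matrix.trace_smul,
      Matrix.trace_mul_comm, ← mul_assoc, singletProj_mul_self, h.trace_cpMap_deriv]
    push_cast
    rw [smul_eq_mul]
    ring
  · intro s t
    simp only [List.ofFn_succ, List.prod_cons, stringSite, Fin.cons_zero, Fin.cons_succ]
    have := stringTail_mul_singletProj (f := W u) hm (fun i => s i.succ) fun i => t i.succ
    rw [mul_assoc, mul_assoc _ _ singletProj, this, mul_assoc singletProj, ← mul_assoc singletProj,
      ← mul_assoc singletProj, singletProj_mul_self]

theorem hsNorm_stringOp (h : IsContracting W W' u p q p' q' lam gam g) {n m : ℕ} (hm : m < n) :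
    hsNorm (stringOp (W u) W' n m) = √(g * gam) * √lam ^ m := by
  rw [hsNorm, hsNormSq, h.hsInner_stringOp_self hm, Complex.ofReal_re,
    Real.sqrt_mul (mul_pos h.g_pos h.gam_pos).le, sqrt_pow_of_nonneg h.lam_nonneg]

theorem avgMap_octet (h : IsContracting W W' u p q p' q' lam gam g) (n : ℕ) :
    avgMap (fun (_ : Fin n) s t => W u s t * octetProj) octetProj =
      ((lam : ℂ) ^ n) • octetProj := by
  induction n with
  | zero => rw [avgMap_zero, pow_zero, one_smul]
  | succ n ih => rw [avgMap_succ, ih, cpMap_smul, h.cpMap_octet, smul_smul, pow_succ]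

/-- The trace around the ring is bounded by the Cauchy-Schwarz inequality, after which the octet
blocks contract as they do in a string. -/
theorem exists_hsNorm_windingOp_le (h : IsContracting W W' u p q p' q' lam gam g) :
    ∃ C : ℝ, 0 ≤ C ∧ ∀ n, hsNorm (windingOp (W u) W' n) ≤ C * √lam ^ n := by
  set x : ℝ := (cpMap (fun s t => octetProj * W' s t) octetProj).trace.re with hx
  refine ⟨√(9 * x), Real.sqrt_nonneg _, fun n => ?_⟩
  set f : Fin (n + 1) → Fin 3 → Fin 3 → PairOp :=
    Fin.cons (fun s t => octetProj * W' s t) fun _ s t => W u s t * octetProj with hf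
  have h1 : (avgMap f octetProj).trace.re = lam ^ n * x := by
    have e0 : f 0 = fun s t => octetProj * W' s t := rfl
    have e1 : (fun i : Fin n => f i.succ) = fun _ s t => W u s t * octetProj := rfl
    rw [avgMap_succ, e0, e1, h.avgMap_octet, cpMap_smul, Matrix.trace_smul, smul_eq_mul,
      ← Complex.ofReal_pow, Complex.re_ofReal_mul]
  have h2 : hsNormSq (windingOp (W u) W' n) ≤ 9 * (avgMap f octetProj).trace.re := by
    rw [hsNormSq_eq_sum, avgMap, Matrix.trace_smul, smul_eq_mul, Matrix.trace_sum]
    simp only [Matrix.trace_sum]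
    have e : ((3 : ℂ) ^ (n + 1))⁻¹ = ((((3 : ℝ) ^ (n + 1))⁻¹ : ℝ) : ℂ) := by push_cast; rfl
    rw [e, Complex.re_ofReal_mul, mul_left_comm, Complex.re_sum]
    refine mul_le_mul_of_nonneg_left ?_ (by positivity)
    rw [Finset.mul_sum]
    refine Finset.sum_le_sum fun s _ => ?_
    rw [Complex.re_sum, Finset.mul_sum]
    refine Finset.sum_le_sum fun t _ => ?_
    rw [windingOp, mpo, Matrix.of_apply, ← hf]
    have h3 : (List.ofFn fun j => f j (s j) (t j)).prod.trace =
        ((List.ofFn fun j => f j (s j) (t j)).prod * octetProj).trace := by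
      rw [Matrix.trace_mul_comm _ octetProj, List.ofFn_succ, List.prod_cons, ← mul_assoc octetProj]
      congr 2
      exact (by rw [← mul_assoc, octetProj_mul_self] :
        octetProj * W' (s 0) (t 0) = octetProj * (octetProj * W' (s 0) (t 0)))
    rw [h3]
    refine (norm_trace_sq_le _).trans_eq ?_
    rw [Matrix.conjTranspose_mul, conjTranspose_octetProj, mul_assoc, ← mul_assoc octetProj,
      octetProj_mul_self, ← mul_assoc]
  calc hsNorm (windingOp (W u) W' n) ≤ √(lam ^ n * (9 * x)) := by
        refine Real.sqrt_le_sqrt (h2.trans_eq ?_)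
        rw [h1]; ring
    _ = √(9 * x) * √lam ^ n := by
        rw [Real.sqrt_mul (pow_nonneg h.lam_nonneg n), sqrt_pow_of_nonneg h.lam_nonneg, mul_comm]

theorem sum_stringSite_zero (h : IsContracting W W' u p q p' q' lam gam g) (n m : ℕ) :
    ∑ s, stringSite (W u) W' n m 0 s s = 0 := by
  simp only [stringSite, Fin.cons_zero]
  rw [← Finset.sum_mul, ← Finset.mul_sum, h.sum_diag_deriv]
  simp [mul_add, singletProj_mul_self, singletProj_mul_octetProj]

theorem sum_stringSite_last (h : IsContracting W W' u p q p' q' lam gam g) {n m : ℕ} (hm : m < n) :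
    ∑ s, stringSite (W u) W' n m (Fin.succ ⟨m, hm⟩) s s = 0 := by
  simp only [stringSite, Fin.cons_succ, stringTail, lt_self_iff_false, if_false, if_true]
  rw [← Finset.sum_mul, ← Finset.mul_sum, h.sum_diag]
  simp [mul_add, octetProj_mul_self, octetProj_mul_singletProj]

theorem stringSite_of_lt {f f' : Fin 3 → Fin 3 → PairOp}
    {n m : ℕ} {j : Fin (n + 1)} (hj : m + 1 < j) (s t : Fin 3) :
    stringSite f f' n m j s t = if s = t then singletProj else 0 := by
  cases j using Fin.cases with
  | zero => simp at hj
  | succ i =>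
    rw [Fin.val_succ] at hj
    simp only [stringSite, Fin.cons_succ, stringTail]
    rw [if_neg (by omega), if_neg (by omega)]

/-- Some end vertex of one of the two strings lies outside of the other string, which acts there
as the identity, while the vertex has vanishing partial trace. -/
theorem hsInner_shiftOp_stringOp (h : IsContracting W W' u p q p' q' lam gam g) {n m m' : ℕ}
    (hm : m + m' + 1 < n) {k l : Fin (n + 1)} (hne : (k, m) ≠ (l, m')) :
    hsInner (shiftOp k (stringOp (W u) W' n m)) (shiftOp l (stringOp (W u) W' n m')) = 0 := by
  rw [stringOp, stringOp, shiftOp_mpo, shiftOp_mpo]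
  by_cases hkl : k = l
  · subst hkl
    -- of two strings with the same first site, only the longer one sees its own last site
    have key : ∀ {a b : ℕ}, a < b → b < n →
        hsInner (mpo fun j => stringSite (W u) W' n a (j - k))
          (mpo fun j => stringSite (W u) W' n b (j - k)) = 0 := by
      intro a b hab hb
      refine hsInner_mpo_eq_zero (Fin.succ ⟨b, hb⟩ + k) (F := singletProj) ?_ ?_
      · intro s t
        rw [add_sub_cancel_right]
        exact stringSite_of_lt (by simpa using hab) s t
      · rw [add_sub_cancel_right]
        exact h.sum_stringSite_last hb
    rcases lt_or_gt_of_ne (fun e => hne (by rw [e]) : m ≠ m') with hlt | hlt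
    · exact key hlt (by omega)
    · rw [← star_hsInner, key hlt (by omega), star_zero]
  · -- the strings cannot both contain the first site of the other one
    have key : ∀ {a b : ℕ} {i j : Fin (n + 1)}, a + 1 < (j - i : Fin (n + 1)) →
        hsInner (mpo fun x => stringSite (W u) W' n a (x - i))
          (mpo fun x => stringSite (W u) W' n b (x - j)) = 0 := by
      intro a b i j hij
      refine hsInner_mpo_eq_zero j (F := singletProj) (fun s t => stringSite_of_lt hij s t) ?_
      rw [sub_self]
      exact h.sum_stringSite_zero n b
    by_cases h1 : m + 1 < (l - k : Fin (n + 1))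
    · exact key h1
    · rw [← star_hsInner, key, star_zero]
      have h2 : (l - k) + (k - l) = 0 := by abel
      have h3 : ((l - k : Fin (n + 1)) + (k - l : Fin (n + 1)) : ℕ) % (n + 1) = 0 := by
        rw [← Fin.val_add, h2, Fin.val_zero]
      have h4 : (l - k : Fin (n + 1)).val ≠ 0 := fun e =>
        hkl (sub_eq_zero.1 (Fin.ext e)).symm
      have h5 := Nat.le_of_dvd (by omega) (Nat.dvd_of_mod_eq_zero h3)
      omega

end IsContracting

/-! ### The norm per site -/

theorem trace_mpo {ι : Type*} [Fintype ι] [DecidableEq ι] {L : ℕ}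
    (f : Fin L → Fin 3 → Fin 3 → Matrix ι ι ℂ) :
    (mpo f).trace = (List.ofFn fun j => ∑ s, f j s s).prod.trace := by
  rw [← sum_prod_ofFn fun j s => f j s s, Matrix.trace_sum]
  rfl

theorem tracelessPart_add_smul_one {L : ℕ} (A : Op L) (c : ℂ) :
    tracelessPart (c • (1 : Op L) + A) = tracelessPart A := by
  rw [tracelessPart_eq, tracelessPart_eq, hsInner_add_right, hsInner_smul_right, hsInner_one_one,
    mul_one, add_smul]
  abel

theorem tracelessPart_add {L : ℕ} (A B : Op L) :
    tracelessPart (A + B) = tracelessPart A + tracelessPart B := by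
  rw [tracelessPart_eq, tracelessPart_eq, tracelessPart_eq, hsInner_add_right, add_smul]
  abel

theorem tracelessPart_smul {L : ℕ} (A : Op L) (c : ℂ) :
    tracelessPart (c • A) = c • tracelessPart A := by
  rw [tracelessPart_eq, tracelessPart_eq, hsInner_smul_right, smul_sub, smul_smul]

theorem abs_hsNorm_add_sub_le {L : ℕ} (A B : Op L) : |hsNorm (A + B) - hsNorm A| ≤ hsNorm B := by
  rw [abs_sub_le_iff]
  constructor
  · linarith [hsNorm_add_le A B]
  · have h := hsNorm_add_le (A + B) ((-1 : ℂ) • B)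
    have h1 : hsNorm ((-1 : ℂ) • B) = hsNorm B := by
      rw [hsNorm, hsNormSq_smul]
      simp [hsNorm]
    have h2 : A + B + (-1 : ℂ) • B = A := by
      rw [neg_one_smul]; abel
    rw [h1, h2] at h
    linarith

namespace IsContracting

variable {W : ℂ → Fin 3 → Fin 3 → PairOp}
  {W' : Fin 3 → Fin 3 → PairOp} {u : ℂ}
  {p q : ℂ → ℂ} {p' q' : ℂ} {lam gam g : ℝ}

theorem hsInner_one_shiftOp_stringOp (h : IsContracting W W' u p q p' q' lam gam g) {n : ℕ}
    (k : Fin (n + 1)) (m : ℕ) : hsInner 1 (shiftOp k (stringOp (W u) W' n m)) = 0 := by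
  rw [← shiftOp_one k, hsInner_shiftOp, hsInner_one_left, stringOp, trace_mpo, List.prod_eq_zero,
    Matrix.trace_zero, mul_zero]
  rw [List.mem_ofFn]
  exact ⟨0, h.sum_stringSite_zero n m⟩

/-- The charge is a scalar plus the short strings, which leave the octet after fewer than `M` sites,
plus a remainder. -/
theorem sum_mpo_eq (h : IsContracting W W' u p q p' q' lam gam g) {n M : ℕ} (hM : M ≤ n) :
    ∑ k : Fin (n + 1), (mpo fun j => if j = k then W' else W u) =
      ((n + 1 : ℂ) * p') • (1 : Op (n + 1)) +
      (∑ x ∈ Finset.univ ×ˢ Finset.range M, shiftOp x.1 (stringOp (W u) W' n x.2) +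
      ∑ k, shiftOp k (∑ m ∈ Finset.Ico M n, stringOp (W u) W' n m + windingOp (W u) W' n)) := by
  have h1 : ∀ k : Fin (n + 1), (mpo fun j => if j = k then W' else W u) =
      p' • (1 : Op (n + 1)) + (∑ m ∈ Finset.range M, shiftOp k (stringOp (W u) W' n m) +
        shiftOp k (∑ m ∈ Finset.Ico M n, stringOp (W u) W' n m + windingOp (W u) W' n)) := by
    intro k
    have h2 : (mpo fun j => if j = k then W' else W u) =
        shiftOp k (mpo fun j : Fin (n + 1) => if j = 0 then W' else W u) := by
      rw [shiftOp_mpo]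
      simp only [sub_eq_zero]
    rw [h2, h.density_eq, ← Finset.sum_range_add_sum_Ico _ hM]
    simp only [shiftOp_add, shiftOp_smul, shiftOp_one, shiftOp_sum]
    abel
  rw [Finset.sum_congr rfl fun k _ => h1 k, Finset.sum_add_distrib, Finset.sum_add_distrib,
    Finset.sum_product, Finset.sum_const, Finset.card_univ, Fintype.card_fin,
    ← Nat.cast_smul_eq_nsmul ℂ, smul_smul]
  push_cast
  rfl

theorem hsNormSq_sum_stringOp (h : IsContracting W W' u p q p' q' lam gam g) {n M : ℕ}
    (hM : 2 * M ≤ n) :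
    hsNormSq (∑ x ∈ Finset.univ ×ˢ Finset.range M, shiftOp x.1 (stringOp (W u) W' n x.2)) =
      (n + 1) * ∑ m ∈ Finset.range M, g * gam * lam ^ m := by
  rw [hsNormSq, hsInner_sum_self, Finset.sum_product]
  · have h1 : ∀ m ∈ Finset.range M, hsInner (stringOp (W u) W' n m) (stringOp (W u) W' n m) =
        ((g * gam * lam ^ m : ℝ) : ℂ) := fun m hm =>
      h.hsInner_stringOp_self (by have := Finset.mem_range.1 hm; omega)
    simp only [hsInner_shiftOp, Finset.sum_congr rfl h1, Finset.sum_const, Finset.card_univ,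
      Fintype.card_fin, nsmul_eq_mul, ← Complex.ofReal_sum]
    rw [← Complex.ofReal_natCast, ← Complex.ofReal_mul, Complex.ofReal_re]
    push_cast
    rfl
  · rintro ⟨k, m⟩ hx ⟨l, m'⟩ hy hne
    simp only [Finset.mem_product, Finset.mem_univ, true_and, Finset.mem_range] at hx hy
    exact h.hsInner_shiftOp_stringOp (by omega) hne

/-- The squared norm per site converges to the sum of the squared norms of the strings. -/
theorem tendsto_hsNormSq (h : IsContracting W W' u p q p' q' lam gam g) {c : ℂ} (hc : ‖c‖ = 1) :
    Filter.Tendsto (fun L : ℕ => hsNormSq (tracelessPart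
      (c • ∑ k : Fin L, mpo fun j => if j = k then W' else W u)) / (L : ℝ)) Filter.atTop
      (nhds (g * gam * (1 - lam)⁻¹)) := by
  rw [← Filter.tendsto_add_atTop_iff_nat 1]
  obtain ⟨C, hC, hw⟩ := h.exists_hsNorm_windingOp_le
  set r : ℝ := √lam with hr
  have hr0 : 0 ≤ r := Real.sqrt_nonneg _
  have hr1 : r < 1 := by
    rw [hr, Real.sqrt_lt' one_pos, one_pow]
    exact h.lam_lt_one
  set K : ℝ := √(g * gam) + C with hK
  set A : (n : ℕ) → Op (n + 1) := fun n => tracelessPart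
    (c • ∑ k : Fin (n + 1), mpo fun j => if j = k then W' else W u) with hA
  set S : (n : ℕ) → Op (n + 1) := fun n => ∑ x ∈ Finset.univ ×ˢ Finset.range (n / 2),
    shiftOp x.1 (stringOp (W u) W' n x.2) with hS
  -- strings longer than half of the ring, which may overlap with their translates at both ends,
  -- are negligible, as is the winding term
  have hE : ∀ n, |hsNorm (A n) - hsNorm (S n)| ≤ (n + 1) ^ 2 * K * r ^ (n / 2) := by
    intro n
    have hM : n / 2 ≤ n := Nat.div_le_self n 2
    set E : Op (n + 1) := ∑ k, shiftOp k
      (∑ m ∈ Finset.Ico (n / 2) n, stringOp (W u) W' n m + windingOp (W u) W' n) with hE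
    have hS1 : tracelessPart (S n) = S n := by
      rw [tracelessPart_eq, hS]
      simp only [hsInner_sum_right, h.hsInner_one_shiftOp_stringOp, Finset.sum_const_zero,
        zero_smul, sub_zero]
    have hA1 : hsNorm (A n) = hsNorm (S n + tracelessPart E) := by
      rw [hA]
      simp only
      rw [h.sum_mpo_eq hM, tracelessPart_smul, tracelessPart_add_smul_one, tracelessPart_add, hS1,
        hsNorm, hsNormSq_smul, hc, one_pow, one_mul, hsNorm]
    rw [hA1]
    refine (abs_hsNorm_add_sub_le _ _).trans ?_
    have h1 : hsNorm (tracelessPart E) ≤ hsNorm E :=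
      Real.sqrt_le_sqrt (hsNormSq_tracelessPart_le E)
    have h2 : ∀ m ∈ Finset.Ico (n / 2) n,
        hsNorm (stringOp (W u) W' n m) ≤ √(g * gam) * r ^ (n / 2) := by
      intro m hm
      rw [Finset.mem_Ico] at hm
      rw [h.hsNorm_stringOp hm.2]
      exact mul_le_mul_of_nonneg_left (pow_le_pow_of_le_one hr0 hr1.le hm.1) (Real.sqrt_nonneg _)
    have h3 : hsNorm (∑ m ∈ Finset.Ico (n / 2) n, stringOp (W u) W' n m + windingOp (W u) W' n) ≤
        (n + 1) * K * r ^ (n / 2) := by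
      have h4 : ∑ m ∈ Finset.Ico (n / 2) n, hsNorm (stringOp (W u) W' n m) ≤
          (n + 1) * (√(g * gam) * r ^ (n / 2)) := by
        refine (Finset.sum_le_card_nsmul _ _ _ h2).trans ?_
        rw [Nat.card_Ico, nsmul_eq_mul]
        refine mul_le_mul_of_nonneg_right ?_ (by positivity)
        have : ((n - n / 2 : ℕ) : ℝ) ≤ n := by exact_mod_cast Nat.sub_le _ _
        linarith
      have h5 : hsNorm (windingOp (W u) W' n) ≤ (n + 1) * (C * r ^ (n / 2)) := by
        refine (hw n).trans ?_
        have h6 : C * r ^ n ≤ C * r ^ (n / 2) :=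
          mul_le_mul_of_nonneg_left (pow_le_pow_of_le_one hr0 hr1.le hM) hC
        have h7 : 0 ≤ (n : ℝ) * (C * r ^ (n / 2)) := by positivity
        linarith
      refine (hsNorm_add_le _ _).trans ?_
      have h8 := hsNorm_sum_le (Finset.Ico (n / 2) n) (stringOp (W u) W' n)
      rw [hK]
      linarith
    have h9 : hsNorm E ≤ (n + 1) * ((n + 1) * K * r ^ (n / 2)) := by
      rw [hE]
      refine (hsNorm_sum_le _ _).trans ?_
      refine (Finset.sum_le_card_nsmul _ _ ((n + 1) * K * r ^ (n / 2)) fun k _ => ?_).trans ?_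
      · rw [hsNorm_shiftOp]
        exact h3
      · rw [Finset.card_univ, Fintype.card_fin, nsmul_eq_mul]
        push_cast
        rfl
    refine (h1.trans h9).trans_eq ?_
    ring
  have hlim0 : Filter.Tendsto (fun n : ℕ => ((n : ℝ) + 1) ^ 2 * K * r ^ (n / 2)) Filter.atTop
      (nhds 0) := by
    have h1 : Filter.Tendsto (fun M : ℕ => (4 * K) * ((M : ℝ) ^ 2 * r ^ M) +
        (8 * K) * ((M : ℝ) ^ 1 * r ^ M) + (4 * K) * r ^ M) Filter.atTop (nhds 0) := by
      simpa using (((tendsto_pow_const_mul_const_pow_of_lt_one 2 hr0 hr1).const_mul (4 * K)).add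
        ((tendsto_pow_const_mul_const_pow_of_lt_one 1 hr0 hr1).const_mul (8 * K))).add
        ((tendsto_pow_atTop_nhds_zero_of_lt_one hr0 hr1).const_mul (4 * K))
    have h2 := h1.comp (Nat.tendsto_div_const_atTop (two_ne_zero))
    have hK0 : 0 ≤ K := by positivity
    refine squeeze_zero (fun n => by positivity) (fun n => ?_) h2
    have h3 : (n : ℝ) + 1 ≤ 2 * ((n / 2 : ℕ) : ℝ) + 2 := by
      have : n + 1 ≤ 2 * (n / 2) + 2 := by omega
      exact_mod_cast this
    calc ((n : ℝ) + 1) ^ 2 * K * r ^ (n / 2)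
        ≤ (2 * ((n / 2 : ℕ) : ℝ) + 2) ^ 2 * K * r ^ (n / 2) := by gcongr
      _ = _ := by simp only [Function.comp_apply]; ring
  have hgeo : Filter.Tendsto (fun n : ℕ => √(∑ m ∈ Finset.range (n / 2), g * gam * lam ^ m))
      Filter.atTop (nhds √(g * gam * (1 - lam)⁻¹)) := by
    refine (Real.continuous_sqrt.tendsto _).comp ?_
    have := ((hasSum_geometric_of_lt_one h.lam_nonneg h.lam_lt_one).mul_left
      (g * gam)).tendsto_sum_nat
    exact this.comp (Nat.tendsto_div_const_atTop two_ne_zero)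
  have hlim : Filter.Tendsto (fun n : ℕ => hsNorm (A n) / √(n + 1)) Filter.atTop
      (nhds √(g * gam * (1 - lam)⁻¹)) := by
    have hdiff : Filter.Tendsto (fun n : ℕ => hsNorm (A n) / √(n + 1) -
        √(∑ m ∈ Finset.range (n / 2), g * gam * lam ^ m)) Filter.atTop (nhds 0) := by
      refine squeeze_zero_norm (fun n => ?_) hlim0
      have hpos : 1 ≤ √((n : ℝ) + 1) := by
        rw [Real.one_le_sqrt]
        have : (0 : ℝ) ≤ n := Nat.cast_nonneg n
        linarith
      have h1 : hsNorm (S n) = √(n + 1) * √(∑ m ∈ Finset.range (n / 2), g * gam * lam ^ m) := by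
        rw [hsNorm, hS, h.hsNormSq_sum_stringOp (by omega), Real.sqrt_mul (by positivity)]
      have h2 : hsNorm (A n) / √(n + 1) - √(∑ m ∈ Finset.range (n / 2), g * gam * lam ^ m) =
          (hsNorm (A n) - hsNorm (S n)) / √(n + 1) := by
        rw [h1]
        field_simp
      rw [h2, Real.norm_eq_abs, abs_div, abs_of_pos (zero_lt_one.trans_le hpos)]
      exact (div_le_self (abs_nonneg _) hpos).trans (hE n)
    simpa using hdiff.add hgeo
  have hpos : 0 ≤ g * gam * (1 - lam)⁻¹ :=
    mul_nonneg (mul_pos h.g_pos h.gam_pos).le (inv_nonneg.2 (sub_nonneg.2 h.lam_lt_one.le))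
  have := hlim.pow 2
  rw [Real.sq_sqrt hpos] at this
  refine this.congr fun n => ?_
  rw [div_pow, hsNorm_sq, Real.sq_sqrt (by positivity)]
  push_cast
  rfl

end IsContracting

/-- The charges of an `R`-matrix are quasi-local if its site matrices are contracting. -/
theorem isQuasiLocal_of_isContracting {M : ℂ → TwoOp} {u : ℂ} {M' : TwoOp}
    (hM : ∀ a b, HasDerivAt (fun v => M v a b) (M' a b) u)
    {W' : Fin 3 → Fin 3 → PairOp}
    {p q : ℂ → ℂ} {p' q' : ℂ} {lam gam g : ℝ}
    (h : IsContracting (siteFamily M u) W' u p q p' q' lam gam g) :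
    IsQuasiLocal fun L => tracelessPart (chargeOf M u L) where
  traceless L := trace_tracelessPart _
  translation_invariant L := tracelessPart_chargeOf_translation M u L
  norm_sq_linear := by
    refine ⟨g * gam * (1 - lam)⁻¹, mul_pos (mul_pos h.g_pos h.gam_pos)
      (inv_pos.2 (sub_pos.2 h.lam_lt_one)), ?_⟩
    simp only [chargeOf_eq_sum hM h.hasDerivAt]
    exact h.tendsto_hsNormSq (by simp)
  local_overlap k b := by
    simp only [chargeOf_eq_sum hM h.hasDerivAt]
    exact h.local_overlap b _

/-! ### Site matrices built from the permutation and from the trace operator -/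

section CpMap

variable (f : Fin 3 → Fin 3 → PairOp)

theorem cpMap_octetProj_eq : cpMap f octetProj = cpMap f 1 - cpMap f singletProj := by
  simp only [cpMap, octetProj, mul_sub, sub_mul, Finset.sum_sub_distrib, smul_sub]

theorem cpMap_one_apply (a b c d : Fin 3) :
    cpMap f 1 (a, b) (c, d) = 3⁻¹ * ∑ s, ∑ t, ∑ k, ∑ l,
      f s t (a, b) (k, l) * star (f s t (c, d) (k, l)) := by
  simp [cpMap, Matrix.smul_apply, Matrix.sum_apply, Matrix.mul_apply, Fintype.sum_prod_type]

theorem cpMap_singletProj_apply (a b c d : Fin 3) :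
    cpMap f singletProj (a, b) (c, d) = 9⁻¹ * ∑ s, ∑ t,
      (∑ k, f s t (a, b) (k, k)) * star (∑ k, f s t (c, d) (k, k)) := by
  have h : ∀ s t, (f s t * singletProj * (f s t)ᴴ) (a, b) (c, d) =
      3⁻¹ * ((∑ k, f s t (a, b) (k, k)) * star (∑ k, f s t (c, d) (k, k))) := by
    intro s t
    simp only [Matrix.mul_apply, Fintype.sum_prod_type, singletProj_apply, ite_and, mul_ite,
      mul_zero, Finset.sum_ite_irrel, Finset.sum_const_zero, Finset.sum_ite_eq,
      Finset.mem_univ, if_true, ite_mul, zero_mul, Matrix.conjTranspose_apply, star_sum,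
      Finset.mul_sum, Finset.sum_mul]
    refine Finset.sum_congr rfl fun _ _ => Finset.sum_congr rfl fun _ _ => ?_
    ring
  simp only [cpMap, Matrix.smul_apply, Matrix.sum_apply, h, ← Finset.mul_sum, smul_eq_mul]
  ring

theorem trace_singletProj_mul_eq (Z : PairOp) :
    (singletProj * Z).trace = 3⁻¹ * ∑ a, ∑ c, Z (a, a) (c, c) := by
  simp only [Matrix.trace, Matrix.diag, Matrix.mul_apply, Fintype.sum_prod_type, singletProj_apply,
    ite_and, ite_mul, zero_mul, Finset.sum_ite_irrel, Finset.sum_const_zero, Finset.sum_ite_eq,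
    Finset.mem_univ, if_true, Finset.mul_sum]
  rw [Finset.sum_comm]
  refine Finset.sum_congr rfl fun _ _ => Finset.sum_congr rfl fun _ _ => ?_
  norm_num

theorem octetProj_apply (a b c d : Fin 3) : octetProj (a, b) (c, d) =
    (if a = c then if b = d then 1 else 0 else 0) -
      if a = b then if c = d then 1 / 3 else 0 else 0 := by
  simp only [octetProj, Matrix.sub_apply, singletProj_apply, Matrix.one_apply, Prod.mk.injEq,
    ite_and]

end CpMap

section Defining

/-- The site matrix of the product of two transfer matrices whose `R`-matrices are combinations of
the identity and of the permutation. The parameters are the products of the coefficients: `x` for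
the identity twice, `y` for the permutation in the second factor, `z` for the permutation in the
first factor, `w` for the permutation twice. -/
def permSite (x y z w : ℂ) (s t : Fin 3) : PairOp :=
  Matrix.of fun i j =>
    x * (if s = t then if i.1 = j.1 then if i.2 = j.2 then 1 else 0 else 0 else 0) +
    y * (if i.1 = j.1 then if s = j.2 then if i.2 = t then 1 else 0 else 0 else 0) +
    z * (if s = i.1 then if j.1 = t then if i.2 = j.2 then 1 else 0 else 0 else 0) +
    w * (if s = i.1 then if j.1 = j.2 then if i.2 = t then 1 else 0 else 0 else 0)

theorem permSite_apply (x y z w : ℂ) (s t a b c d : Fin 3) :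
    permSite x y z w s t (a, b) (c, d) =
      (if s = t then if a = c then if b = d then x else 0 else 0 else 0) +
      (if a = c then if s = d then if b = t then y else 0 else 0 else 0) +
      (if s = a then if c = t then if b = d then z else 0 else 0 else 0) +
      (if s = a then if c = d then if b = t then w else 0 else 0 else 0) := by
  simp [permSite]

theorem sum_permSite (x y z w : ℂ) : ∑ s, permSite x y z w s s =
    (3 : ℂ) • ((x + (y + z) / 3 + w) • singletProj + (x + (y + z) / 3) • octetProj) := by
  ext ⟨a, b⟩ ⟨c, d⟩
  simp only [Matrix.sum_apply, permSite_apply, Matrix.smul_apply, Matrix.add_apply,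
    singletProj_apply, octetProj_apply, smul_eq_mul, Finset.sum_add_distrib, Finset.sum_ite_irrel,
    Finset.sum_const_zero, Finset.sum_ite_eq', Finset.mem_univ, if_true,
    Finset.sum_const, Finset.card_univ, Fintype.card_fin, nsmul_eq_mul, ite_and,
    eq_comm (a := b) (b := a), eq_comm (a := c) (b := a)]
  split_ifs <;> push_cast <;> ring

theorem trace_singletProj_mul_permSite (x y z w : ℂ) (s t : Fin 3) :
    (singletProj * permSite x y z w s t).trace =
      if s = t then x + (y + z) / 3 + w else 0 := by
  rw [trace_singletProj_mul_eq]
  simp only [permSite_apply, Finset.sum_add_distrib, Finset.sum_ite_irrel,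
    Finset.sum_const_zero, Finset.sum_ite_eq, Finset.sum_ite_eq', Finset.mem_univ, if_true,
    Finset.sum_const, Finset.card_univ, Fintype.card_fin, nsmul_eq_mul]
  split_ifs <;> push_cast <;> ring

theorem singletProj_mul_permSite {x y z w : ℂ} (h1 : y + z = 0) (h2 : x + w = 1) (s t : Fin 3) :
    singletProj * permSite x y z w s t = if s = t then singletProj else 0 := by
  ext ⟨a, b⟩ ⟨c, d⟩
  have h3 : (if s = t then singletProj else 0) (a, b) (c, d) =
      if s = t then singletProj (a, b) (c, d) else 0 := by split_ifs <;> rfl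
  rw [h3]
  obtain rfl : z = -y := by linear_combination h1
  obtain rfl : w = 1 - x := by linear_combination h2
  simp only [Matrix.mul_apply, Fintype.sum_prod_type, singletProj_apply, ite_and, permSite_apply,
    mul_add, mul_ite, ite_mul, zero_mul, mul_zero, Finset.sum_add_distrib, Finset.sum_ite_irrel,
    Finset.sum_const_zero, Finset.sum_ite_eq, Finset.sum_ite_eq', Finset.mem_univ, if_true,
    eq_comm (a := c) (b := t)]
  split_ifs <;> ring

theorem cpMap_permSite_one (x y z w : ℂ) (a b c d : Fin 3) :
    cpMap (permSite x y z w) 1 (a, b) (c, d) =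
      (if a = c then if b = d then x * star x + y * star y + z * star z + w * star w +
        3⁻¹ * (x * star y + y * star x + x * star z + z * star x + w * star y + y * star w +
          w * star z + z * star w) else 0 else 0) +
      if a = b then if c = d then 3⁻¹ * (x * star w + w * star x + y * star z + z * star y)
        else 0 else 0 := by
  rw [cpMap_one_apply]
  simp only [permSite_apply, star_add, apply_ite star, star_zero]
  simp only [mul_add, add_mul, ite_mul, mul_ite, zero_mul, mul_zero, Finset.sum_add_distrib,
    Finset.sum_ite_eq, Finset.sum_ite_eq', Finset.mem_univ, if_true, Finset.sum_ite_irrel,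
    Finset.sum_const_zero, Finset.sum_const, Finset.card_univ, Fintype.card_fin, nsmul_eq_mul,
    eq_comm (a := b) (b := a), eq_comm (a := c) (b := a)]
  split_ifs <;> push_cast <;> ring

theorem cpMap_permSite_singletProj (x y z w : ℂ) (a b c d : Fin 3) :
    cpMap (permSite x y z w) singletProj (a, b) (c, d) =
      (if a = c then if b = d then 9⁻¹ * ((y + z + 3 * w) * star (y + z + 3 * w)) else 0 else 0) +
      if a = b then if c = d then 9⁻¹ * (3 * x * star x + x * star (y + z + 3 * w) +
        (y + z + 3 * w) * star x) else 0 else 0 := by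
  rw [cpMap_singletProj_apply]
  simp only [permSite_apply, Finset.sum_add_distrib, Finset.sum_ite_eq, Finset.sum_ite_eq',
    Finset.mem_univ, if_true, Finset.sum_ite_irrel, Finset.sum_const_zero, Finset.sum_const,
    Finset.card_univ, Fintype.card_fin, nsmul_eq_mul, star_add, apply_ite star, star_zero,
    star_mul', star_natCast, star_ofNat]
  simp only [mul_add, add_mul, ite_mul, mul_ite, zero_mul, mul_zero, Finset.sum_add_distrib,
    Finset.sum_ite_eq, Finset.sum_ite_eq', Finset.mem_univ, if_true, Finset.sum_ite_irrel,
    Finset.sum_const_zero, Finset.sum_const, Finset.card_univ, Fintype.card_fin, nsmul_eq_mul,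
    eq_comm (a := b) (b := a), eq_comm (a := c) (b := a), eq_comm (a := d) (b := c)]
  split_ifs <;> push_cast <;> ring

theorem trace_cpMap_permSite_octetProj (x y z w : ℂ) :
    (singletProj * cpMap (permSite x y z w) octetProj).trace =
      8 / 9 * ((y + z) * star (y + z)) := by
  rw [trace_singletProj_mul_eq, cpMap_octetProj_eq]
  simp only [Matrix.sub_apply, cpMap_permSite_one, cpMap_permSite_singletProj,
    Finset.sum_add_distrib, Finset.sum_sub_distrib, Finset.sum_ite_eq,
    Finset.mem_univ, if_true, Finset.sum_const,
    Finset.card_univ, Fintype.card_fin, nsmul_eq_mul, star_add, star_mul', star_ofNat]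
  push_cast
  ring

theorem cpMap_permSite_octet {x y z w : ℂ} (h1 : y + z = 0) (h2 : x + w = 1) :
    cpMap (permSite x y z w) octetProj = (x * star x + 2 * (y * star y)) • octetProj := by
  obtain rfl : z = -y := by linear_combination h1
  obtain rfl : w = 1 - x := by linear_combination h2
  rw [cpMap_octetProj_eq]
  ext ⟨a, b⟩ ⟨c, d⟩
  simp only [Matrix.sub_apply, cpMap_permSite_one, cpMap_permSite_singletProj, Matrix.smul_apply,
    octetProj_apply, smul_eq_mul, star_add, star_sub, star_neg, star_mul', star_ofNat, star_one]
  split_ifs <;> ring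

theorem cpMap_permSite_singlet {x y z w : ℂ} (h1 : y + z = 0) (h2 : x + w = 1) :
    cpMap (permSite x y z w) singletProj = singletProj + (w * star w) • octetProj := by
  obtain rfl : z = -y := by linear_combination h1
  obtain rfl : w = 1 - x := by linear_combination h2
  ext ⟨a, b⟩ ⟨c, d⟩
  simp only [cpMap_permSite_singletProj, Matrix.smul_apply, Matrix.add_apply, singletProj_apply,
    octetProj_apply, smul_eq_mul, star_add, star_sub, star_neg, star_mul', star_ofNat, star_one,
    ite_and]
  split_ifs <;> ring

end Defining

section Conjugate

/-- The site matrix of the product of two transfer matrices whose `R`-matrices are combinations of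
the identity and of the trace operator. The parameters are as in `permSite`. -/
def traceSite (x y z w : ℂ) (s t : Fin 3) : PairOp :=
  Matrix.of fun i j =>
    x * (if s = t then if i.1 = j.1 then if i.2 = j.2 then 1 else 0 else 0 else 0) +
    y * (if i.1 = j.1 then if s = i.2 then if j.2 = t then 1 else 0 else 0 else 0) +
    z * (if s = j.1 then if i.1 = t then if i.2 = j.2 then 1 else 0 else 0 else 0) +
    w * (if s = j.1 then if i.1 = i.2 then if j.2 = t then 1 else 0 else 0 else 0)

theorem traceSite_apply (x y z w : ℂ) (s t a b c d : Fin 3) :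
    traceSite x y z w s t (a, b) (c, d) =
      (if s = t then if a = c then if b = d then x else 0 else 0 else 0) +
      (if a = c then if s = b then if d = t then y else 0 else 0 else 0) +
      (if s = c then if a = t then if b = d then z else 0 else 0 else 0) +
      (if s = c then if a = b then if d = t then w else 0 else 0 else 0) := by
  simp [traceSite]

theorem sum_traceSite (x y z w : ℂ) : ∑ s, traceSite x y z w s s =
    (3 : ℂ) • ((x + (y + z) / 3 + w) • singletProj + (x + (y + z) / 3) • octetProj) := by
  ext ⟨a, b⟩ ⟨c, d⟩
  simp only [Matrix.sum_apply, traceSite_apply, Matrix.smul_apply, Matrix.add_apply,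
    singletProj_apply, octetProj_apply, smul_eq_mul, Finset.sum_add_distrib, Finset.sum_ite_irrel,
    Finset.sum_const_zero, Finset.sum_ite_eq', Finset.mem_univ, if_true,
    Finset.sum_const, Finset.card_univ, Fintype.card_fin, nsmul_eq_mul, ite_and,
    eq_comm (a := d) (b := b), eq_comm (a := d) (b := c)]
  split_ifs <;> push_cast <;> ring

theorem trace_singletProj_mul_traceSite (x y z w : ℂ) (s t : Fin 3) :
    (singletProj * traceSite x y z w s t).trace =
      if s = t then x + (y + z) / 3 + w else 0 := by
  rw [trace_singletProj_mul_eq]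
  simp only [traceSite_apply, Finset.sum_add_distrib, Finset.sum_ite_irrel,
    Finset.sum_const_zero, Finset.sum_ite_eq, Finset.sum_ite_eq', Finset.mem_univ, if_true,
    Finset.sum_const, Finset.card_univ, Fintype.card_fin, nsmul_eq_mul, eq_comm (a := t) (b := s)]
  split_ifs <;> push_cast <;> ring

theorem singletProj_mul_traceSite {y z w : ℂ} (h1 : y + z + 3 * w = 0) (s t : Fin 3) :
    singletProj * traceSite 1 y z w s t = if s = t then singletProj else 0 := by
  ext ⟨a, b⟩ ⟨c, d⟩
  have h3 : (if s = t then singletProj else 0) (a, b) (c, d) =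
      if s = t then singletProj (a, b) (c, d) else 0 := by split_ifs <;> rfl
  rw [h3]
  obtain rfl : z = -y - 3 * w := by linear_combination h1
  simp only [Matrix.mul_apply, Fintype.sum_prod_type, singletProj_apply, ite_and, traceSite_apply,
    mul_add, mul_ite, ite_mul, zero_mul, mul_zero, Finset.sum_add_distrib, Finset.sum_ite_irrel,
    Finset.sum_const_zero, Finset.sum_ite_eq, Finset.sum_ite_eq', Finset.mem_univ, if_true,
    Finset.sum_const, Finset.card_univ, Fintype.card_fin, nsmul_eq_mul,
    eq_comm (a := c) (b := s), eq_comm (a := d) (b := t)]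
  split_ifs <;> push_cast <;> ring

theorem cpMap_traceSite_one (x y z w : ℂ) (a b c d : Fin 3) :
    cpMap (traceSite x y z w) 1 (a, b) (c, d) =
      (if a = c then if b = d then x * star x + y * star y + z * star z +
        3⁻¹ * (x * star y + y * star x + x * star z + z * star x) else 0 else 0) +
      if a = b then if c = d then 3 * (w * star w) + (y + z) * star w + w * star (y + z) +
        3⁻¹ * (x * star w + w * star x + y * star z + z * star y) else 0 else 0 := by
  rw [cpMap_one_apply]
  simp only [traceSite_apply, star_add, apply_ite star, star_zero]
  simp only [mul_add, add_mul, ite_mul, mul_ite, zero_mul, mul_zero, Finset.sum_add_distrib,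
    Finset.sum_ite_eq, Finset.sum_ite_eq', Finset.mem_univ, if_true, Finset.sum_ite_irrel,
    Finset.sum_const_zero, Finset.sum_const, Finset.card_univ, Fintype.card_fin, nsmul_eq_mul,
    eq_comm (a := b) (b := a), eq_comm (a := d) (b := c), eq_comm (a := d) (b := b)]
  split_ifs <;> push_cast <;> ring

theorem cpMap_traceSite_singletProj (x y z w : ℂ) (a b c d : Fin 3) :
    cpMap (traceSite x y z w) singletProj (a, b) (c, d) =
      (if a = c then if b = d then 9⁻¹ * ((y + z) * star (y + z)) else 0 else 0) +
      if a = b then if c = d then 9⁻¹ * (3 * ((x + w) * star (x + w)) + (x + w) * star (y + z) +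
        (y + z) * star (x + w)) else 0 else 0 := by
  rw [cpMap_singletProj_apply]
  simp only [traceSite_apply, Finset.sum_add_distrib, Finset.sum_ite_eq,
    Finset.mem_univ, if_true, Finset.sum_ite_irrel, Finset.sum_const_zero,
    star_add, apply_ite star, star_zero]
  simp only [mul_add, add_mul, ite_mul, mul_ite, zero_mul, mul_zero, Finset.sum_add_distrib,
    Finset.sum_ite_eq, Finset.sum_ite_eq', Finset.mem_univ, if_true, Finset.sum_ite_irrel,
    Finset.sum_const_zero, Finset.sum_const, Finset.card_univ, Fintype.card_fin, nsmul_eq_mul,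
    eq_comm (a := b) (b := a), eq_comm (a := d) (b := c), eq_comm (a := d) (b := b)]
  split_ifs <;> push_cast <;> ring

theorem trace_cpMap_traceSite_octetProj (x y z w : ℂ) :
    (singletProj * cpMap (traceSite x y z w) octetProj).trace =
      8 / 9 * ((y + z + 3 * w) * star (y + z + 3 * w)) := by
  rw [trace_singletProj_mul_eq, cpMap_octetProj_eq]
  simp only [Matrix.sub_apply, cpMap_traceSite_one, cpMap_traceSite_singletProj,
    Finset.sum_add_distrib, Finset.sum_sub_distrib, Finset.sum_ite_eq,
    Finset.mem_univ, if_true, Finset.sum_const,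
    Finset.card_univ, Fintype.card_fin, nsmul_eq_mul, star_add, star_mul', star_ofNat]
  push_cast
  ring

theorem cpMap_traceSite_octet {y z w : ℂ} (h1 : y + z + 3 * w = 0) :
    cpMap (traceSite 1 y z w) octetProj =
      (1 + y * star y + z * star z - w * star w - (w + star w)) • octetProj := by
  obtain rfl : z = -y - 3 * w := by linear_combination h1
  rw [cpMap_octetProj_eq]
  ext ⟨a, b⟩ ⟨c, d⟩
  simp only [Matrix.sub_apply, cpMap_traceSite_one, cpMap_traceSite_singletProj, Matrix.smul_apply,
    octetProj_apply, smul_eq_mul, star_add, star_sub, star_neg, star_mul', star_ofNat, star_one]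
  split_ifs <;> ring

theorem cpMap_traceSite_singlet {y z w : ℂ} (h1 : y + z + 3 * w = 0) :
    cpMap (traceSite 1 y z w) singletProj = singletProj + (w * star w) • octetProj := by
  obtain rfl : z = -y - 3 * w := by linear_combination h1
  ext ⟨a, b⟩ ⟨c, d⟩
  simp only [cpMap_traceSite_singletProj, Matrix.smul_apply, Matrix.add_apply, singletProj_apply,
    octetProj_apply, smul_eq_mul, star_add, star_sub, star_neg, star_mul', star_ofNat, star_one,
    ite_and]
  split_ifs <;> ring

end Conjugate

/-! ### The physical strip -/

theorem hasDerivAt_smul_one_add_smul {x y : ℂ → ℂ} {x' y' u : ℂ} (hx : HasDerivAt x x' u)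
    (hy : HasDerivAt y y' u) (T : TwoOp) (a b : Fin 3 × Fin 3) :
    HasDerivAt (fun v => (x v • (1 : TwoOp) + y v • T) a b)
      ((x' • (1 : TwoOp) + y' • T) a b) u := by
  simp only [Matrix.add_apply, Matrix.smul_apply, smul_eq_mul]
  exact (hx.mul_const _).add (hy.mul_const _)

theorem siteFamily_permOp (x y : ℂ → ℂ) (u v : ℂ) :
    siteFamily (fun z => x z • (1 : TwoOp) + y z • permOp) u v =
      permSite (x (-u) * x v) (x (-u) * y v) (y (-u) * x v) (y (-u) * y v) := by
  funext s t
  ext ⟨a, b⟩ ⟨c, d⟩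
  rw [siteFamily_apply, permSite_apply]
  simp only [Matrix.add_apply, Matrix.smul_apply, smul_eq_mul, Matrix.one_apply, Prod.mk.injEq,
    permOp, Matrix.of_apply, ite_and, mul_add, add_mul, mul_ite, ite_mul, mul_one, zero_mul,
    mul_zero, Finset.sum_add_distrib,
    Finset.sum_ite_eq', Finset.mem_univ, if_true, eq_comm (a := c) (b := a)]
  split_ifs <;> ring

theorem siteFamily_traceOp (x y : ℂ → ℂ) (u v : ℂ) :
    siteFamily (fun z => x z • (1 : TwoOp) + y z • traceOp) u v =
      traceSite (x (-u) * x v) (x (-u) * y v) (y (-u) * x v) (y (-u) * y v) := by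
  funext s t
  ext ⟨a, b⟩ ⟨c, d⟩
  rw [siteFamily_apply, traceSite_apply]
  simp only [Matrix.add_apply, Matrix.smul_apply, smul_eq_mul, Matrix.one_apply, Prod.mk.injEq,
    traceOp, Matrix.of_apply, ite_and, mul_add, add_mul, mul_ite, ite_mul, mul_one, zero_mul,
    mul_zero, Finset.sum_add_distrib,
    Finset.sum_ite_eq', Finset.mem_univ, if_true, eq_comm (a := c) (b := a),
    eq_comm (a := t) (b := a), eq_comm (a := t) (b := d), eq_comm (a := b) (b := a)]
  split_ifs <;> ring

/-- The hypotheses `h1` and `h2` express the unitarity of `x + y P`, with `x₁`, `y₁` the values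
of the coefficients at the reflected spectral parameter. -/
theorem isContracting_permSite {x y : ℂ → ℂ} {x' y' x₁ y₁ u : ℂ} (hx : HasDerivAt x x' u)
    (hy : HasDerivAt y y' u) (h1 : x₁ * y u + y₁ * x u = 0) (h2 : x₁ * x u + y₁ * y u = 1)
    {lam gam g : ℝ} (hlam : (lam : ℂ) = x₁ * x u * star (x₁ * x u) +
      2 * (x₁ * y u * star (x₁ * y u)))
    (hgam : (gam : ℂ) = y₁ * y u * star (y₁ * y u))
    (hg : (g : ℂ) = 8 / 9 * ((x₁ * y' + y₁ * x') * star (x₁ * y' + y₁ * x')))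
    (hlam0 : 0 ≤ lam) (hlam1 : lam < 1) (hgam0 : 0 < gam) (hg0 : 0 < g) (hq : ‖x₁ * x u‖ < 1) :
    IsContracting (fun v => permSite (x₁ * x v) (x₁ * y v) (y₁ * x v) (y₁ * y v))
      (permSite (x₁ * x') (x₁ * y') (y₁ * x') (y₁ * y')) u
      (fun v => x₁ * x v + (x₁ * y v + y₁ * x v) / 3 + y₁ * y v)
      (fun v => x₁ * x v + (x₁ * y v + y₁ * x v) / 3)
      (x₁ * x' + (x₁ * y' + y₁ * x') / 3 + y₁ * y') (x₁ * x' + (x₁ * y' + y₁ * x') / 3)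
      lam gam g where
  hasDerivAt s t a b := by
    simp only [permSite, Matrix.of_apply]
    exact (((((hx.const_mul x₁).mul_const _).add ((hy.const_mul x₁).mul_const _)).add
      ((hx.const_mul y₁).mul_const _)).add ((hy.const_mul y₁).mul_const _))
  singletProj_mul := singletProj_mul_permSite h1 h2
  sum_diag v := sum_permSite _ _ _ _
  trace_singletProj_mul v := trace_singletProj_mul_permSite _ _ _ _
  hasDerivAt_singlet := (((hx.const_mul x₁).add
    (((hy.const_mul x₁).add (hx.const_mul y₁)).div_const 3)).add (hy.const_mul y₁))
  hasDerivAt_octet := (hx.const_mul x₁).add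
    (((hy.const_mul x₁).add (hx.const_mul y₁)).div_const 3)
  norm_octet_lt := by rwa [h1, zero_div, add_zero]
  lam_nonneg := hlam0
  lam_lt_one := hlam1
  gam_pos := hgam0
  g_pos := hg0
  cpMap_octetProj := by rw [cpMap_permSite_octet h1 h2, hlam]
  cpMap_singletProj := by rw [cpMap_permSite_singlet h1 h2, hgam]
  trace_cpMap_deriv := by rw [trace_cpMap_permSite_octetProj, hg]

/-- The hypothesis `h1` expresses the unitarity of `x + y K`, normalized by `x = 1`, with `y₁` the
value of the coefficient of `K` at the reflected spectral parameter. -/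
theorem isContracting_traceSite {x y : ℂ → ℂ} {y' y₁ u : ℂ} (hx : HasDerivAt x 0 u)
    (hx1 : x u = 1) (hy : HasDerivAt y y' u) (h1 : y u + y₁ + 3 * (y₁ * y u) = 0)
    {lam gam g : ℝ} (hlam : (lam : ℂ) = 1 + y u * star (y u) + y₁ * star y₁ -
      y₁ * y u * star (y₁ * y u) - (y₁ * y u + star (y₁ * y u)))
    (hgam : (gam : ℂ) = y₁ * y u * star (y₁ * y u))
    (hg : (g : ℂ) = 8 / 9 * ((y' + 3 * (y₁ * y')) * star (y' + 3 * (y₁ * y'))))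
    (hlam0 : 0 ≤ lam) (hlam1 : lam < 1) (hgam0 : 0 < gam) (hg0 : 0 < g)
    (hq : ‖1 - y₁ * y u‖ < 1) :
    IsContracting (fun v => traceSite (x v) (y v) (y₁ * x v) (y₁ * y v))
      (traceSite 0 y' (y₁ * 0) (y₁ * y')) u
      (fun v => x v + (y v + y₁ * x v) / 3 + y₁ * y v) (fun v => x v + (y v + y₁ * x v) / 3)
      (0 + (y' + y₁ * 0) / 3 + y₁ * y') (0 + (y' + y₁ * 0) / 3) lam gam g where
  hasDerivAt s t a b := by
    simp only [traceSite, Matrix.of_apply]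
    exact (((hx.mul_const _).add (hy.mul_const _)).add ((hx.const_mul y₁).mul_const _)).add
      ((hy.const_mul y₁).mul_const _)
  singletProj_mul := by
    simp only [hx1, mul_one]
    exact singletProj_mul_traceSite h1
  sum_diag v := sum_traceSite _ _ _ _
  trace_singletProj_mul v := trace_singletProj_mul_traceSite _ _ _ _
  hasDerivAt_singlet := (hx.add ((hy.add (hx.const_mul y₁)).div_const 3)).add (hy.const_mul y₁)
  hasDerivAt_octet := hx.add ((hy.add (hx.const_mul y₁)).div_const 3)
  norm_octet_lt := by
    have e : x u + (y u + y₁ * x u) / 3 = 1 - y₁ * y u := by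
      rw [hx1]
      linear_combination h1 / 3
    rwa [e]
  lam_nonneg := hlam0
  lam_lt_one := hlam1
  gam_pos := hgam0
  g_pos := hg0
  cpMap_octetProj := by simp only [hx1, mul_one, cpMap_traceSite_octet h1, hlam]
  cpMap_singletProj := by simp only [hx1, mul_one, cpMap_traceSite_singlet h1, hgam]
  trace_cpMap_deriv := by rw [trace_cpMap_traceSite_octetProj, hg, mul_zero, add_zero]

section Strip

variable {u : ℂ}

theorem im_sq_lt_of_mem_physicalStrip (hu : u ∈ physicalStrip) : u.im ^ 2 < 1 / 4 := by
  have h : u.im ^ 2 < (1 / 2) ^ 2 := sq_lt_sq' (abs_lt.1 hu).1 (abs_lt.1 hu).2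
  linarith

theorem normSq_sq_add (u : ℂ) (r : ℝ) : Complex.normSq (u ^ 2 + r) =
    (u.re ^ 2 - u.im ^ 2 + r) ^ 2 + 4 * (u.re ^ 2 * u.im ^ 2) := by
  simp only [Complex.normSq_apply, pow_two, Complex.add_re, Complex.add_im, Complex.mul_re,
    Complex.mul_im, Complex.ofReal_re, Complex.ofReal_im]
  ring

theorem normSq_sq_add_pos (hu : u ∈ physicalStrip) {r : ℝ} (hr : 1 ≤ r) :
    0 < Complex.normSq (u ^ 2 + r) := by
  have := im_sq_lt_of_mem_physicalStrip hu
  rw [normSq_sq_add]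
  have h1 : 0 < u.re ^ 2 - u.im ^ 2 + r := by nlinarith [sq_nonneg u.re]
  positivity

theorem norm_lt_one_of_normSq {z : ℂ} (h : Complex.normSq z < 1) : ‖z‖ < 1 := by
  rw [Complex.normSq_eq_norm_sq] at h
  exact (sq_lt_one_iff₀ (norm_nonneg z)).1 h

theorem isQuasiLocal_X (hu : u ∈ physicalStrip) :
    IsQuasiLocal fun L => tracelessPart (X u L) := by
  have him := im_sq_lt_of_mem_physicalStrip hu
  have hpos := normSq_sq_add_pos hu le_rfl
  have hN : u ^ 2 + 1 ≠ 0 := by simpa using Complex.normSq_pos.1 hpos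
  have hI := Complex.I_sq
  have ha : u + Complex.I ≠ 0 := fun h => hN (by linear_combination (u - Complex.I) * h + hI)
  have hb : -u + Complex.I ≠ 0 := fun h => hN (by linear_combination (-u - Complex.I) * h + hI)
  have hR : R = fun v => (v * (v + Complex.I)⁻¹) • (1 : TwoOp) +
      (Complex.I * (v + Complex.I)⁻¹) • permOp := by
    funext v
    rw [R, smul_add, smul_smul, smul_smul, mul_comm, mul_comm Complex.I]
  set a := (u + Complex.I)⁻¹ with had
  set n := (u ^ 2 + 1)⁻¹ with hnd
  have hn : n = -(a * (-u + Complex.I)⁻¹) := by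
    rw [hnd, had, ← mul_inv, ← inv_neg]
    congr 1
    linear_combination hI
  have hn1 : n * (u ^ 2 + 1) = 1 := inv_mul_cancel₀ hN
  have hi : HasDerivAt (fun v : ℂ => (v + Complex.I)⁻¹) (-a ^ 2) u :=
    (((hasDerivAt_id u).add_const Complex.I).inv ha).congr_deriv (by
      rw [had, inv_pow, id, neg_div, one_div])
  have hx : HasDerivAt (fun v => v * (v + Complex.I)⁻¹) (a + u * -a ^ 2) u :=
    ((hasDerivAt_id u).mul hi).congr_deriv (by rw [one_mul]; rfl)
  have hy : HasDerivAt (fun v => Complex.I * (v + Complex.I)⁻¹) (Complex.I * -a ^ 2) u :=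
    hi.const_mul _
  set b := (-u + Complex.I)⁻¹ with hbd
  have exx : -u * b * (u * a) = u ^ 2 * n := by rw [hn]; ring
  have exy : -u * b * (Complex.I * a) = Complex.I * u * n := by rw [hn]; ring
  have eyx : Complex.I * b * (u * a) = -(Complex.I * u * n) := by rw [hn]; ring
  have eyy : Complex.I * b * (Complex.I * a) = n := by rw [hn]; linear_combination (a * b) * hI
  have ed : -u * b * (Complex.I * -a ^ 2) + Complex.I * b * (a + u * -a ^ 2) =
      -(Complex.I * n) := by rw [hn]; ring
  -- `ν` is the squared norm of `(u² + 1)⁻¹`; in terms of it `1 - lam = (1 - 4 (Im u)²) ν`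
  set ν : ℝ := Complex.normSq n with hν
  have hν1 : ν * ((u.re ^ 2 - u.im ^ 2 + 1) ^ 2 + 4 * (u.re ^ 2 * u.im ^ 2)) = 1 := by
    rw [← normSq_sq_add, hν, ← map_mul, Complex.ofReal_one, hn1, map_one]
  have hν0 : 0 < ν := Complex.normSq_pos.2 (inv_ne_zero hN)
  have hnu : Complex.normSq u = u.re ^ 2 + u.im ^ 2 := by rw [Complex.normSq_apply]; ring
  have hs : ∀ z : ℂ, z * star z = (Complex.normSq z : ℂ) := Complex.mul_conj
  have key : IsContracting _ _ u _ _ _ _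
      (ν * ((u.re ^ 2 + u.im ^ 2) ^ 2 + 2 * (u.re ^ 2 + u.im ^ 2))) ν (8 / 9 * ν) :=
    isContracting_permSite (x₁ := -u * b) (y₁ := Complex.I * b) hx hy
      (by rw [exy, eyx, add_neg_cancel]) (by rw [exx, eyy]; linear_combination hn1)
      (by
        rw [exx, exy, hs, hs]
        simp only [map_mul, map_pow, Complex.normSq_I, hnu, ← hν]
        push_cast
        ring)
      (by rw [eyy, hs])
      (by
        rw [ed, hs, Complex.normSq_neg, map_mul, Complex.normSq_I, one_mul]
        push_cast
        rfl)
      (by positivity) (by nlinarith) hν0 (by positivity)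
      (by
        rw [exx]
        apply norm_lt_one_of_normSq
        rw [map_mul, map_pow, hnu, ← hν]
        nlinarith [mul_nonneg hν0.le (sq_nonneg u.re), mul_nonneg hν0.le (sq_nonneg u.im)])
  have hW : siteFamily R u = fun v => permSite (-u * b * (v * (v + Complex.I)⁻¹))
      (-u * b * (Complex.I * (v + Complex.I)⁻¹)) (Complex.I * b * (v * (v + Complex.I)⁻¹))
      (Complex.I * b * (Complex.I * (v + Complex.I)⁻¹)) := by
    funext v
    rw [hR]
    exact siteFamily_permOp (fun v => v * (v + Complex.I)⁻¹)
      (fun v => Complex.I * (v + Complex.I)⁻¹) u v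
  have hM : ∀ p q, HasDerivAt (fun v => R v p q)
      (((a + u * -a ^ 2) • (1 : TwoOp) + (Complex.I * -a ^ 2) • permOp) p q) u := by
    rw [hR]
    exact hasDerivAt_smul_one_add_smul hx hy permOp
  rw [← hW] at key
  exact isQuasiLocal_of_isContracting hM key

theorem isQuasiLocal_Y (hu : u ∈ physicalStrip) :
    IsQuasiLocal fun L => tracelessPart (Y u L) := by
  have him := im_sq_lt_of_mem_physicalStrip hu
  have hpos := normSq_sq_add_pos hu (r := 9 / 4) (by norm_num)
  have hN : u ^ 2 + 9 / 4 ≠ 0 := by simpa using Complex.normSq_pos.1 hpos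
  have hI := Complex.I_sq
  set c : ℂ := 3 * Complex.I / 2 with hc
  have hc2 : c ^ 2 = -(9 / 4) := by rw [hc]; linear_combination 9 / 4 * hI
  have ha : u + c ≠ 0 := fun h => hN (by linear_combination (u - c) * h + hc2)
  have hb : -u + c ≠ 0 := fun h => hN (by linear_combination (-u - c) * h + hc2)
  have hR : Rbar = fun v => ((v + c)⁻¹ * (v + c)) • (1 : TwoOp) +
      (-(Complex.I * (v + c)⁻¹)) • traceOp := by
    funext v
    rw [Rbar, smul_sub, smul_smul, smul_smul, sub_eq_add_neg, ← neg_smul, mul_comm Complex.I]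
  set a := (u + c)⁻¹ with had
  set b := (-u + c)⁻¹ with hbd
  set n := (u ^ 2 + 9 / 4)⁻¹ with hnd
  have ha1 : a * (u + c) = 1 := inv_mul_cancel₀ ha
  have hb1 : b * (-u + c) = 1 := inv_mul_cancel₀ hb
  have hn1 : n * (u ^ 2 + 9 / 4) = 1 := inv_mul_cancel₀ hN
  have hn : n = -(a * b) := by
    rw [hnd, had, hbd, ← mul_inv, ← inv_neg]
    congr 1
    linear_combination hc2
  have hab : a + b = 2 * c * (a * b) := by linear_combination -(a * hb1) - b * ha1
  have hi : HasDerivAt (fun v : ℂ => (v + c)⁻¹) (-a ^ 2) u :=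
    (((hasDerivAt_id u).add_const c).inv ha).congr_deriv (by
      rw [had, inv_pow, id, neg_div, one_div])
  have hx : HasDerivAt (fun v => (v + c)⁻¹ * (v + c)) 0 u :=
    (hi.mul ((hasDerivAt_id u).add_const c)).congr_deriv (by
      simp only [id]
      linear_combination -(a * ha1))
  have hy : HasDerivAt (fun v => -(Complex.I * (v + c)⁻¹)) (-(Complex.I * -a ^ 2)) u :=
    (hi.const_mul _).neg
  have eyy : -(Complex.I * b) * -(Complex.I * a) = n := by
    rw [hn]; linear_combination (a * b) * hI
  have es : -(Complex.I * a) + -(Complex.I * b) + 3 * (-(Complex.I * b) * -(Complex.I * a)) =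
      0 := by
    rw [hc] at hab
    linear_combination -Complex.I * hab
  have ed : -(Complex.I * -a ^ 2) + 3 * (-(Complex.I * b) * -(Complex.I * -a ^ 2)) =
      Complex.I * n := by
    rw [hc] at hab
    rw [hn]
    linear_combination (Complex.I * a) * hab
  have ea : a = n * (u - c) := by
    rw [hn]
    linear_combination -(a * hb1)
  have eb : b = -(n * (u + c)) := by
    rw [hn]
    linear_combination -(b * ha1)
  -- `ν` is the squared norm of `(u² + 9/4)⁻¹`; in terms of it `1 - lam = (1 - 4 (Im u)²) ν`
  set ν : ℝ := Complex.normSq n with hν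
  have hν1 : ν * ((u.re ^ 2 - u.im ^ 2 + 9 / 4) ^ 2 + 4 * (u.re ^ 2 * u.im ^ 2)) = 1 := by
    rw [← normSq_sq_add, hν, ← map_mul]
    push_cast
    rw [hn1, map_one]
  have hν0 : 0 < ν := Complex.normSq_pos.2 (inv_ne_zero hN)
  have hnc : ∀ s : ℝ, Complex.normSq (u + s * c) = u.re ^ 2 + (u.im + s * (3 / 2)) ^ 2 := by
    intro s
    rw [Complex.normSq_apply, hc]
    simp
    ring
  have hνa : Complex.normSq a = ν * (u.re ^ 2 + (u.im - 3 / 2) ^ 2) := by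
    have := hnc (-1)
    rw [ea, map_mul, ← hν, show u - c = u + ((-1 : ℝ) : ℂ) * c by push_cast; ring, this]
    ring
  have hνb : Complex.normSq b = ν * (u.re ^ 2 + (u.im + 3 / 2) ^ 2) := by
    have := hnc 1
    rw [eb, Complex.normSq_neg, map_mul, ← hν,
      show u + c = u + ((1 : ℝ) : ℂ) * c by push_cast; ring, this]
    ring
  have hnre : n.re = ν * (u.re ^ 2 - u.im ^ 2 + 9 / 4) := by
    rw [hν, hnd, Complex.inv_re, map_inv₀, div_eq_inv_mul]
    congr 1
    simp [pow_two]
  have hs : ∀ z : ℂ, z * star z = (Complex.normSq z : ℂ) := Complex.mul_conj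
  have hadd : ∀ z : ℂ, z + star z = ((2 * z.re : ℝ) : ℂ) := Complex.add_conj
  have key : IsContracting _ _ u _ _ _ _ (1 - (1 - 4 * u.im ^ 2) * ν) ν (8 / 9 * ν) :=
    isContracting_traceSite (y₁ := -(Complex.I * b)) hx ha1 hy es
      (by
        rw [eyy, hs, hs, hs, hadd, Complex.normSq_neg, Complex.normSq_neg, map_mul, map_mul,
          Complex.normSq_I, hνa, hνb, hnre, ← hν]
        push_cast
        ring)
      (by rw [eyy, hs])
      (by
        rw [ed, hs, map_mul, Complex.normSq_I, one_mul]
        push_cast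
        rfl)
      (by
        have h1 : 0 ≤ ν * u.re ^ 2 := by positivity
        have h2 : 0 ≤ ν * u.im ^ 2 := by positivity
        have h3 : 1 ≤ (u.re ^ 2 - u.im ^ 2 + 9 / 4) ^ 2 := by nlinarith [sq_nonneg u.re]
        have h4 : 0 ≤ 4 * (u.re ^ 2 * u.im ^ 2) := by positivity
        nlinarith)
      (by nlinarith) hν0 (by positivity)
      (by
        have e : 1 - -(Complex.I * b) * -(Complex.I * a) = n * (u ^ 2 + (5 / 4 : ℝ)) := by
          rw [eyy]
          push_cast
          linear_combination -hn1
        rw [e]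
        apply norm_lt_one_of_normSq
        rw [map_mul, normSq_sq_add, ← hν]
        nlinarith [mul_nonneg hν0.le (sq_nonneg u.re), mul_nonneg hν0.le (sq_nonneg u.im)])
  have hW : siteFamily Rbar u = fun v => traceSite ((v + c)⁻¹ * (v + c))
      (-(Complex.I * (v + c)⁻¹)) (-(Complex.I * b) * ((v + c)⁻¹ * (v + c)))
      (-(Complex.I * b) * -(Complex.I * (v + c)⁻¹)) := by
    funext v
    rw [hR]
    have := siteFamily_traceOp (fun v => (v + c)⁻¹ * (v + c))
      (fun v => -(Complex.I * (v + c)⁻¹)) u v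
    rw [this, ← hbd, hb1, one_mul, one_mul]
  have hM : ∀ p q, HasDerivAt (fun v => Rbar v p q)
      (((0 : ℂ) • (1 : TwoOp) + (-(Complex.I * -a ^ 2)) • traceOp) p q) u := by
    rw [hR]
    exact hasDerivAt_smul_one_add_smul hx hy traceOp
  rw [← hW] at key
  exact isQuasiLocal_of_isContracting hM key

end Strip

end SU3Chain

theorem mainTheorem2 (u : ℂ) (hu : u ∈ SU3Chain.physicalStrip) :
    SU3Chain.IsQuasiLocal (fun L : ℕ => SU3Chain.tracelessPart (SU3Chain.X u L)) ∧
    SU3Chain.IsQuasiLocal (fun L : ℕ => SU3Chain.tracelessPart (SU3Chain.Y u L)) :=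
  ⟨SU3Chain.isQuasiLocal_X hu, SU3Chain.isQuasiLocal_Y hu⟩
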